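/- **Setting.** Each mode has quadratures with $[\hat q,\hat p]=i$, so the vacuum has covariance matrix $\tfrac12 I$. Gaussian states have zero mean, and $F(\rho,\sigma)=\operatorname{Tr}\sqrt{\sqrt\rho\,\sigma\sqrt\rho}$ is the Bures fidelity. Let $\mathcal E_0$ (background) and $\mathcal E_1$ (target) be Gaussian phase-insensitive channels, $V\mapsto \tau_b V+\nu_b I$ on one mode, with $\tau_b\ge 0$ and $\nu_b\ge |1-\tau_b|/2$ for $b\in\{0,1\}$. Let $N_S\ge 0$, and let $\varphi$ be the two-mode squeezed vacuum state with $N_S$ mean photons per mode, i.e. the Gaussian state with covariance matrix $$\begin{pmatrix}\mu I&\Gamma\\ \Gamma&\mu I\end{pmatrix},\qquad \mu=N_S+\tfrac12,\quad \Gamma=\operatorname{diag}(c,-c),\quad c=\sqrt{\mu^2-\tfrac14}.$$ For $a=(a_1,a_2)\in\{0,1\}^2$ put $\varphi_a=(\mathcal E_{a_1}\otimes\mathcal E_{a_2})(\varphi)$, and define the two-mode sub-fidelities $$F_{0:1}=F(\varphi_{00},\varphi_{01}),\quad F_{1:1}=F(\varphi_{01},\varphi_{10}),\quad F_{0:2}=F(\varphi_{00},\varphi_{11}),\quad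 F_{1:2}=F(\varphi_{01},\varphi_{11}).$$ For a pattern $\boldsymbol i\in\{0,1\}^m$ the $k_{\max}$-LNN protocol ($k_{\max}=m-1$) sends one copy of $\varphi$ through each pair of channels $\mathcal E_{i_j},\mathcal E_{i_k}$ with $1\le j<k\le m$. Its output is the $m(m-1)$-mode Gaussian state $\rho_{\boldsymbol i}=\bigotimes_{j<k}\varphi_{(i_j,i_k)}$, whose covariance matrix is the direct sum of those of the factors. **Claim.** (a) For $a,a'\in\{0,1\}^2$ the fidelity $F(\varphi_a,\varphi_{a'})$ depends on $(a,a')$ only through the numbers of ones in $a$ and in $a'$ and the Hamming distance of $a$ and $a'$, so the four sub-fidelities do not depend on the chosen representatives. (b) Let $\boldsymbol i,\boldsymbol i'\in\{0,1\}^m$ have $u$ and $v$ target channels (ones), respectively, with $u\le v$, let $d$ be their Hamming distance and let $d_{\min}=v-u$. Then $$F(\rho_{\boldsymbol i},\rho_{\boldsymbol i'})=F_{0:1}^{\frac{2d(m-v)-d^2+d\,d_{\min}}{2}}\;F_{1:1}^{\frac{d^2-d_{\min}^2}{4}}\;F_{0:2}^{\frac{d(d-2)+d_{\min}^2}{4}}\;F_{1:2}^{\frac{d(2v-d-d_{\min})}{2}}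 .$$ In particular, if $u=v$, then $$F(\rho_{\boldsymbol i},\rho_{\boldsymbol i'})=F_{0:1}^{\frac{d[2(m-u)-d]}{2}}\;F_{1:1}^{\frac{d^2}{4}}\;F_{0:2}^{\frac{d(d-2)}{4}}\;F_{1:2}^{\frac{d(2u-d)}{2}} .$$ -/

import Mathlib

open MeasureTheory
open scoped InnerProductSpace

noncomputable section

namespace BosonicPattern

/-! ## Operators on a complex Hilbert space: trace, density operators, Bures fidelity -/

section Operators

variable {H : Type*} [NormedAddCommGroup H] [InnerProductSpace ℂ H] [CompleteSpace H]

/-- Some orthonormal (Hilbert) basis of `H`. -/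
def someBasis (H : Type*) [NormedAddCommGroup H] [InnerProductSpace ℂ H] [CompleteSpace H] :
    HilbertBasis (exists_hilbertBasis ℂ H).choose ℂ H :=
  (exists_hilbertBasis ℂ H).choose_spec.choose

/-- The trace `Tr A = ∑ₖ ⟨eₖ, A eₖ⟩`. For a trace-class operator, the only case in which it is
used, the value does not depend on the orthonormal basis. -/
def trace (A : H →L[ℂ] H) : ℂ :=
  ∑' k, ⟪someBasis H k, A (someBasis H k)⟫_ℂ

/-- Density operators: positive operators of trace one. (For a positive operator, the equality
`trace ρ = 1` contains the summability of the diagonal, hence that `ρ` is trace class.) -/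
structure IsDensityOperator (ρ : H →L[ℂ] H) : Prop where
  isPositive : ρ.IsPositive
  trace_eq_one : trace ρ = 1

/-- The Bures fidelity `F(ρ, σ) = ‖√ρ √σ‖₁ = Tr √(√ρ σ √ρ)`. -/
def fidelity (ρ σ : H →L[ℂ] H) : ℝ :=
  (trace (CFC.sqrt (CFC.sqrt ρ * σ * CFC.sqrt ρ))).re

end Operators

/-! ## Bosonic modes, Weyl operators, zero-mean Gaussian states -/

section Gaussian

variable {ι : Type*} [Fintype ι]

/-- The Hilbert space `L²(ℝ^ι)` of a finite family `ι` of bosonic modes. -/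
abbrev ModeSpace (ι : Type*) [Fintype ι] : Type _ :=
  Lp ℂ 2 (volume : Measure (ι → ℝ))

/-- Translation of wave functions, `ψ ↦ ψ(· + t)`. -/
def translate (t : ι → ℝ) : ModeSpace ι →L[ℂ] ModeSpace ι :=
  (Lp.compMeasurePreservingₗᵢ ℂ (fun q : ι → ℝ => q + t)
    (measurePreserving_add_right volume t)).toContinuousLinearMap

/-- The phase `exp(i (s·q + s·t/2))`. -/
def weylPhase (s t q : ι → ℝ) : ℂ :=
  Complex.exp (((∑ j, s j * q j + (∑ j, s j * t j) / 2 : ℝ) : ℂ) * Complex.I)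

lemma norm_weylPhase (s t q : ι → ℝ) : ‖weylPhase s t q‖ = 1 :=
  Complex.norm_exp_ofReal_mul_I _

lemma continuous_weylPhase (s t : ι → ℝ) : Continuous (weylPhase s t) := by
  unfold weylPhase
  fun_prop

lemma memLp_weylPhase_mul (s t : ι → ℝ) (ψ : ModeSpace ι) :
    MemLp (fun q => weylPhase s t q * ψ q) 2 (volume : Measure (ι → ℝ)) := by
  refine (Lp.memLp ψ).of_le
    ((continuous_weylPhase s t).aestronglyMeasurable.mul (Lp.memLp ψ).1) ?_
  filter_upwards with q
  simp [norm_weylPhase]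

/-- Multiplication of wave functions by the phase `weylPhase s t`. -/
def mulPhase (s t : ι → ℝ) : ModeSpace ι →L[ℂ] ModeSpace ι :=
  LinearMap.mkContinuous
    { toFun := fun ψ => (memLp_weylPhase_mul s t ψ).toLp _
      map_add' := by
        intro ψ χ
        ext1
        filter_upwards [(memLp_weylPhase_mul s t (ψ + χ)).coeFn_toLp, Lp.coeFn_add ψ χ,
          (memLp_weylPhase_mul s t ψ).coeFn_toLp, (memLp_weylPhase_mul s t χ).coeFn_toLp,
          Lp.coeFn_add ((memLp_weylPhase_mul s t ψ).toLp _)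
            ((memLp_weylPhase_mul s t χ).toLp _)] with q h1 h2 h3 h4 h5
        rw [h1, h5, Pi.add_apply, h3, h4, h2, Pi.add_apply, mul_add]
      map_smul' := by
        intro c ψ
        ext1
        filter_upwards [(memLp_weylPhase_mul s t (c • ψ)).coeFn_toLp, Lp.coeFn_smul c ψ,
          (memLp_weylPhase_mul s t ψ).coeFn_toLp,
          Lp.coeFn_smul c ((memLp_weylPhase_mul s t ψ).toLp _)] with q h1 h2 h3 h4
        simp only [RingHom.id_apply]
        rw [h1, h4, Pi.smul_apply, h3, h2, Pi.smul_apply, smul_eq_mul, smul_eq_mul]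
        ring }
    1 (by
      intro ψ
      rw [one_mul]
      refine Lp.norm_le_norm_of_ae_le ?_
      filter_upwards [(memLp_weylPhase_mul s t ψ).coeFn_toLp] with q hq
      simp only [LinearMap.coe_mk, AddHom.coe_mk]
      rw [hq, norm_mul, norm_weylPhase, one_mul])

/-- The Weyl operator `W(ξ) = exp(i ∑ⱼ (sⱼ q̂ⱼ + tⱼ p̂ⱼ))` in the Schrödinger representation
(`q̂ⱼ` multiplication by the coordinate, `p̂ⱼ = -i ∂ⱼ`, so `[q̂ⱼ, p̂ⱼ] = i`), where
`sⱼ = ξ (j, 0)` and `tⱼ = ξ (j, 1)`; explicitly `(W(ξ) ψ)(q) = exp(i (s·q + s·t/2)) ψ(q + t)`. -/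
def weyl (ξ : ι × Fin 2 → ℝ) : ModeSpace ι →L[ℂ] ModeSpace ι :=
  mulPhase (fun j => ξ (j, 0)) (fun j => ξ (j, 1)) ∘L translate (fun j => ξ (j, 1))

lemma weyl_apply_ae (ξ : ι × Fin 2 → ℝ) (ψ : ModeSpace ι) :
    (weyl ξ ψ : (ι → ℝ) → ℂ) =ᵐ[volume] fun q =>
      weylPhase (fun j => ξ (j, 0)) (fun j => ξ (j, 1)) q * ψ (q + fun j => ξ (j, 1)) := by
  have h1 := (memLp_weylPhase_mul (fun j => ξ (j, 0)) (fun j => ξ (j, 1))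
    (translate (fun j => ξ (j, 1)) ψ)).coeFn_toLp
  have h2 := Lp.coeFn_compMeasurePreserving ψ
    (measurePreserving_add_right (volume : Measure (ι → ℝ)) (fun j => ξ (j, 1)))
  filter_upwards [h1, h2] with q hq1 hq2
  refine hq1.trans ?_
  congr 1

/-- `ρ` is the Gaussian state with zero first moments and covariance matrix `V`
(`V_{ab} = ½ ⟨{r_a, r_b}⟩`, the vacuum having `V = I/2`): a density operator whose characteristic
function is `Tr[ρ W(ξ)] = exp(-½ ξᵀ V ξ)`. The row and column index `(j, 0)` stands for the
quadrature `q̂ⱼ` and `(j, 1)` for `p̂ⱼ`. -/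
structure IsGaussianState (V : Matrix (ι × Fin 2) (ι × Fin 2) ℝ)
    (ρ : ModeSpace ι →L[ℂ] ModeSpace ι) : Prop where
  isDensityOperator : IsDensityOperator ρ
  charFun_eq : ∀ ξ : ι × Fin 2 → ℝ,
    trace (ρ * weyl ξ) = ((Real.exp (-(1 / 2) * (ξ ⬝ᵥ V.mulVec ξ)) : ℝ) : ℂ)

end Gaussian

/-! ## Channels, probes and protocol -/

/-- A Gaussian phase-insensitive (GPI) channel, with transmissivity `τ` and induced noise `ν`.
The condition `|1 - τ| / 2 ≤ ν` is complete positivity (vacuum noise `1/2`). -/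
structure GPIChannel where
  τ : ℝ
  ν : ℝ
  τ_nonneg : 0 ≤ τ
  noise_ge : |1 - τ| / 2 ≤ ν

/-- Action on covariance matrices of the multi-channel that applies `E k` to mode `k`:
`V ↦ (⨁ √τₖ I) V (⨁ √τₖ I)ᵀ + ⨁ νₖ I`. -/
def channelCM {ι : Type*} [Fintype ι] [DecidableEq ι] (E : ι → GPIChannel)
    (V : Matrix (ι × Fin 2) (ι × Fin 2) ℝ) : Matrix (ι × Fin 2) (ι × Fin 2) ℝ :=
  Matrix.diagonal (fun k => √(E k.1).τ) * V *
      (Matrix.diagonal (fun k => √(E k.1).τ)).transpose +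
    Matrix.diagonal (fun k => (E k.1).ν)

/-- Covariance matrix of the two-mode squeezed vacuum (TMSV) state `φ_μ` with `N` mean photons
per mode: blocks `μ I` on and `diag(c, -c)` off the diagonal, with `μ = N + 1/2` and
`c = √(μ² - 1/4)`. -/
def tmsvCM (N : ℝ) : Matrix (Fin 2 × Fin 2) (Fin 2 × Fin 2) ℝ :=
  Matrix.of fun x y =>
    if x.2 ≠ y.2 then 0
    else if x.1 = y.1 then N + 1 / 2
    else if x.2 = 0 then √((N + 1 / 2) ^ 2 - 1 / 4)
    else -√((N + 1 / 2) ^ 2 - 1 / 4)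

/-- The probe domains of the `k_max`-LNN protocol on `m` channels: all pairs `{j, k}` with
`j < k`. -/
abbrev ProbeDomain (m : ℕ) : Type := {s : Fin m × Fin m // s.1 < s.2}

/-- The `m (m - 1)` modes of the probe: two modes for each probe domain. -/
abbrev ProbeMode (m : ℕ) : Type := ProbeDomain m × Fin 2

/-- The channel that a probe mode goes through: mode `0` of the domain `{j < k}` goes through
channel `j`, and mode `1` through channel `k`. -/
def channelOf {m : ℕ} (x : ProbeMode m) : Fin m :=
  if x.2 = 0 then x.1.1.1 else x.1.1.2

/-- The modified, `m (m - 1)`-length pattern `ν_i` of a pattern `i` (`true` is a target channel,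
`false` a background channel), in which each channel is copied once for each probe domain that
contains it. -/
def modifiedPattern {m : ℕ} (i : Fin m → Bool) (x : ProbeMode m) : Bool :=
  i (channelOf x)

/-- Covariance matrix of the input of the `k_max`-LNN protocol: the direct sum over all probe
domains of the covariance matrix of the TMSV state. -/
def kmaxInputCM (m : ℕ) (N : ℝ) :
    Matrix (ProbeMode m × Fin 2) (ProbeMode m × Fin 2) ℝ :=
  Matrix.of fun x y =>
    if x.1.1 = y.1.1 then tmsvCM N (x.1.2, x.2) (y.1.2, y.2) else 0

/-- `ρ` is the output of the `k_max`-LNN protocol with `N` mean photons per mode on the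
pattern `i`, where `E true` is the target channel and `E false` the background channel. -/
def IsKmaxOutput {m : ℕ} (E : Bool → GPIChannel) (N : ℝ) (i : Fin m → Bool)
    (ρ : ModeSpace (ProbeMode m) →L[ℂ] ModeSpace (ProbeMode m)) : Prop :=
  IsGaussianState (channelCM (fun x => E (modifiedPattern i x)) (kmaxInputCM m N)) ρ

/-- `σ` is the output of a single TMSV state sent through the two channels of the two-channel
pattern `a`. -/
def IsTwoModeOutput (E : Bool → GPIChannel) (N : ℝ) (a : Fin 2 → Bool)
    (σ : ModeSpace (Fin 2) →L[ℂ] ModeSpace (Fin 2)) : Prop :=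
  IsGaussianState (channelCM (fun k => E (a k)) (tmsvCM N)) σ

/-- The number of target channels of a pattern. -/
def targetNumber {m : ℕ} (i : Fin m → Bool) : ℕ :=
  (Finset.univ.filter fun k => i k = true).card

end BosonicPattern

end

open MeasureTheory
open scoped InnerProductSpace

set_option linter.unusedSectionVars false

namespace BosonicPattern

/-! A density operator is determined by its characteristic function (`eq_of_trace_mul_weyl_eq`).
Hence a Gaussian state with a direct-sum covariance matrix is the tensor product of the Gaussian
states of the blocks (`IsGaussianState.isTensorOp`), and exchanging two modes is conjugation by a
unitary. The fidelity is multiplicative on tensor products (`IsHilbertTensor.fidelity_eq_prod`),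
unitarily invariant, and symmetric (`fidelity_comm`). So the fidelity of the protocol is a product
over pairs of channels of two-mode fidelities. Since the TMSV covariance matrix is invariant under
exchange of its modes, each factor is 1 or one of the four sub-fidelities.

The rest is counting. Let n_ab be the number of channels with value a in the first pattern and b in
the second. The exponents of F01, F11, F02, F12 are n_00 (n_01 + n_10), n_01 n_10, (n_01² - n_01 +
n_10² - n_10)/2 and n_11 (n_01 + n_10). Substituting d = n_01 + n_10, v - u = n_01 - n_10, v = n_01
+ n_11 and m = Σ n_ab gives the formula.

Three analytic points carry the proof. For fixed t, the characteristic function is, up to a phase,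
the Fourier transform of q ↦ k(q, q + t), with k the integral kernel of the state; this gives
uniqueness. Products of modulated Gaussians are total in L², which identifies the multimode space as
a tensor power. Finally Tr|C| = Tr|C†| for every bounded C, which gives symmetry. -/

/-! ### Intertwining of the moduli of an operator and its adjoint -/

/-- The moduli of `C` and of `C†` are intertwined by `C`. -/
lemma modulus_intertwine {A : Type*} [CStarAlgebra A] [PartialOrder A] [StarOrderedRing A]
    {C P Q : A} (hP : 0 ≤ P) (hQ : 0 ≤ Q)
    (hPC : P * P = star C * C) (hQC : Q * Q = C * star C) : C * P = Q * C := by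
  have hPs := (IsSelfAdjoint.of_nonneg hP).star_eq
  have hQs := (IsSelfAdjoint.of_nonneg hQ).star_eq
  set D := C * P - Q * C with hD
  -- The defect D solves the homogeneous Sylvester equation QD + DP = 0, because Q²C = CC†C = CP².
  -- Positivity of P and Q then forces D = 0.
  have hQD : Q * D = -(D * P) := by
    have h : Q * Q * C = C * (P * P) := by rw [hPC, hQC, mul_assoc]
    simp only [hD, mul_sub, sub_mul, neg_sub]
    rw [← mul_assoc Q Q C, h]
    simp only [mul_assoc]
  have hE : star D * Q * D = -(star D * D * P) := by
    rw [mul_assoc, hQD, mul_neg, mul_assoc]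
  have hpos : 0 ≤ star D * Q * D := star_left_conjugate_nonneg hQ D
  -- D†QD = -(D†D)P is self-adjoint, so the positive factors D†D and P commute and their product is
  -- positive. Being also the negative of a positive element, it vanishes.
  have hcomm : Commute (star D * D) P := by
    have h := (IsSelfAdjoint.of_nonneg hpos).star_eq
    rw [hE, star_neg, star_mul, star_mul, star_star, hPs] at h
    exact (neg_injective h).symm
  have h0 : star D * D * P = 0 := by
    refine le_antisymm ?_ (Commute.mul_nonneg (star_mul_self_nonneg D) hP hcomm)
    rw [hE] at hpos
    exact neg_nonneg.1 hpos
  have hDP : D * P = 0 := by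
    rw [← CStarRing.star_mul_self_eq_zero_iff, star_mul, hPs, mul_assoc, ← mul_assoc (star D), h0,
      mul_zero]
  have hQD' : Q * D = 0 := by rw [hQD, hDP, neg_zero]
  -- P need not be injective, so DP = 0 is not yet enough; but D†D = P C†D has a left factor P that
  -- D annihilates.
  have hDD : star D * D = P * (star C * D) := by
    have h : star D = P * star C - star C * Q := by
      simp only [hD, star_sub, star_mul, hPs, hQs]
    rw [h, sub_mul, mul_assoc (star C), hQD', mul_zero, sub_zero, mul_assoc]
  have hDDD : D * star D * D = 0 := by
    rw [mul_assoc, hDD, ← mul_assoc, hDP, zero_mul]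
  have h1 : star D * D = 0 := by
    rw [← CStarRing.star_mul_self_eq_zero_iff, star_mul, star_star, mul_assoc, ← mul_assoc D,
      hDDD, mul_zero]
  exact sub_eq_zero.1 ((CStarRing.star_mul_self_eq_zero_iff D).1 h1)

/-! ## Traces of positive operators -/

section PositiveTrace

open ContinuousLinearMap
open scoped ENNReal

variable {H : Type*} [NormedAddCommGroup H] [InnerProductSpace ℂ H] [CompleteSpace H]

/-- Parseval with values in [0, ∞], where double sums may be exchanged without any summability
condition. -/
lemma tsum_ofReal_norm_inner_sq {I : Type*} (b : HilbertBasis I ℂ H) (x : H) :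
    ∑' i, ENNReal.ofReal (‖⟪b i, x⟫_ℂ‖ ^ 2) = ENNReal.ofReal (‖x‖ ^ 2) := by
  have h := b.hasSum_inner_mul_inner x x
  have h2 : HasSum (fun i => ‖⟪b i, x⟫_ℂ‖ ^ 2) (‖x‖ ^ 2) := by
    have h3 := Complex.hasSum_re h
    convert! h3 using 1
    · funext i
      rw [← inner_conj_symm x, Complex.conj_mul', ← Complex.ofReal_pow, Complex.ofReal_re]
    · exact (inner_self_eq_norm_sq (𝕜 := ℂ) x).symm
  rw [← h2.tsum_eq, ENNReal.ofReal_tsum_of_nonneg (fun _ => by positivity) h2.summable]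

/-- The Hilbert-Schmidt norm of an operator does not depend on the basis, and agrees with that
of its adjoint. -/
lemma tsum_ofReal_norm_sq_adjoint {I J : Type*} (b : HilbertBasis I ℂ H) (c : HilbertBasis J ℂ H)
    (A : H →L[ℂ] H) :
    ∑' i, ENNReal.ofReal (‖A (b i)‖ ^ 2) = ∑' j, ENNReal.ofReal (‖star A (c j)‖ ^ 2) := by
  simp_rw [← tsum_ofReal_norm_inner_sq c (A _), ← tsum_ofReal_norm_inner_sq b (star A _)]
  rw [ENNReal.tsum_comm]
  refine tsum_congr fun j => tsum_congr fun i => ?_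
  rw [star_eq_adjoint, adjoint_inner_right, norm_inner_symm]

/-- The trace of a positive operator, with values in `[0, ∞]`. -/
noncomputable def etrace (A : H →L[ℂ] H) : ℝ≥0∞ :=
  ∑' k, ENNReal.ofReal (⟪someBasis H k, A (someBasis H k)⟫_ℂ).re

lemma re_inner_star_mul_self (S : H →L[ℂ] H) (x : H) :
    (⟪x, (star S * S) x⟫_ℂ).re = ‖S x‖ ^ 2 := by
  rw [mul_apply_eq_comp, star_eq_adjoint, adjoint_inner_right]
  exact inner_self_eq_norm_sq (𝕜 := ℂ) _

lemma star_sqrt (A : H →L[ℂ] H) : star (CFC.sqrt A) = CFC.sqrt A :=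
  (IsSelfAdjoint.of_nonneg (CFC.sqrt_nonneg A)).star_eq

lemma star_sqrt_mul_sqrt {A : H →L[ℂ] H} (hA : 0 ≤ A) : star (CFC.sqrt A) * CFC.sqrt A = A := by
  rw [star_sqrt, CFC.sqrt_mul_sqrt_self A]

lemma etrace_star_mul_self {I : Type*} (b : HilbertBasis I ℂ H) (S : H →L[ℂ] H) :
    etrace (star S * S) = ∑' i, ENNReal.ofReal (‖S (b i)‖ ^ 2) := by
  unfold etrace
  simp_rw [re_inner_star_mul_self]
  -- Passing to the adjoint twice replaces the chosen basis by `b`.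
  rw [tsum_ofReal_norm_sq_adjoint _ b, tsum_ofReal_norm_sq_adjoint b b, star_star]

/-- Cyclicity of the trace for positive products; with values in [0, ∞] it needs no trace-class
condition. -/
lemma etrace_mul_star_self (S : H →L[ℂ] H) : etrace (S * star S) = etrace (star S * S) := by
  have h := etrace_star_mul_self (someBasis H) (star S)
  rw [star_star] at h
  rw [h, etrace_star_mul_self (someBasis H), tsum_ofReal_norm_sq_adjoint _ (someBasis H), star_star]

lemma etrace_eq {I : Type*} (b : HilbertBasis I ℂ H) {A : H →L[ℂ] H} (hA : 0 ≤ A) :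
    etrace A = ∑' i, ENNReal.ofReal (⟪b i, A (b i)⟫_ℂ).re := by
  conv_lhs => rw [← star_sqrt_mul_sqrt hA]
  rw [etrace_star_mul_self b]
  refine tsum_congr fun i => ?_
  conv_rhs => rw [← star_sqrt_mul_sqrt hA, re_inner_star_mul_self]

lemma inner_eq_ofReal_re {A : H →L[ℂ] H} (hA : 0 ≤ A) (x : H) :
    ⟪x, A x⟫_ℂ = ((⟪x, A x⟫_ℂ).re : ℂ) := by
  have h := ((nonneg_iff_isPositive A).1 hA).isSymmetric.im_inner_self_apply x
  refine Complex.ext (by simp) ?_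
  simpa using h

lemma re_inner_nonneg {A : H →L[ℂ] H} (hA : 0 ≤ A) (x : H) : 0 ≤ (⟪x, A x⟫_ℂ).re :=
  ((nonneg_iff_isPositive A).1 hA).re_inner_nonneg_right x

/-- No trace-class condition is needed: if the diagonal is not summable, both sides take the default
value 0. -/
lemma trace_eq_ofReal_toReal_etrace {A : H →L[ℂ] H} (hA : 0 ≤ A) :
    trace A = ((etrace A).toReal : ℂ) := by
  unfold trace etrace
  rw [ENNReal.tsum_toReal_eq (fun _ => ENNReal.ofReal_ne_top), Complex.ofReal_tsum]
  refine tsum_congr fun k => ?_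
  rw [ENNReal.toReal_ofReal (re_inner_nonneg hA _), ← inner_eq_ofReal_re hA]

lemma isDensityOperator_iff {ρ : H →L[ℂ] H} :
    IsDensityOperator ρ ↔ 0 ≤ ρ ∧ etrace ρ = 1 := by
  constructor
  · intro h
    have h0 := (nonneg_iff_isPositive ρ).2 h.isPositive
    have h1 := h.trace_eq_one
    rw [trace_eq_ofReal_toReal_etrace h0] at h1
    refine ⟨h0, ?_⟩
    rw [← ENNReal.toReal_eq_one_iff]
    exact_mod_cast h1
  · rintro ⟨h0, h1⟩
    refine ⟨(nonneg_iff_isPositive ρ).1 h0, ?_⟩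
    rw [trace_eq_ofReal_toReal_etrace h0, h1]
    simp

lemma fidelity_eq (ρ σ : H →L[ℂ] H) :
    fidelity ρ σ = (etrace (CFC.sqrt (CFC.sqrt ρ * σ * CFC.sqrt ρ))).toReal := by
  unfold fidelity
  have h : 0 ≤ CFC.sqrt (CFC.sqrt ρ * σ * CFC.sqrt ρ) :=
    CFC.sqrt_nonneg (CFC.sqrt ρ * σ * CFC.sqrt ρ)
  rw [trace_eq_ofReal_toReal_etrace h, Complex.ofReal_re]

lemma fidelity_self {ρ : H →L[ℂ] H} (hρ : IsDensityOperator ρ) : fidelity ρ ρ = 1 := by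
  obtain ⟨h0, h1⟩ := isDensityOperator_iff.1 hρ
  have h : CFC.sqrt ρ * ρ * CFC.sqrt ρ = ρ * ρ := by
    have := CFC.sqrt_mul_sqrt_self ρ h0
    calc CFC.sqrt ρ * ρ * CFC.sqrt ρ
        = CFC.sqrt ρ * (CFC.sqrt ρ * CFC.sqrt ρ) * CFC.sqrt ρ := by rw [this]
      _ = (CFC.sqrt ρ * CFC.sqrt ρ) * (CFC.sqrt ρ * CFC.sqrt ρ) := by simp only [mul_assoc]
      _ = ρ * ρ := by rw [this]
  rw [fidelity_eq, h, CFC.sqrt_mul_self ρ h0, h1, ENNReal.toReal_one]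

/-! ### Symmetry of the fidelity -/

/-- The resolvent-type regularization `x² / (x + ε)` of a positive operator. -/
lemma exists_regularization {A : Type*} [CStarAlgebra A] [PartialOrder A] [StarOrderedRing A]
    {P : A} (hP : 0 ≤ P) {ε : ℝ} (hε : 0 < ε) :
    ∃ R T : A, star T = T ∧ T * T = R ∧ R * (P + algebraMap ℝ A ε) = 1 ∧
      (P + algebraMap ℝ A ε) * R = 1 ∧ Commute T P ∧
      P * P * R ≤ P ∧ P ≤ P * P * R + algebraMap ℝ A ε := by
  have hPs := IsSelfAdjoint.of_nonneg hP
  have hsp : ∀ x ∈ spectrum ℝ P, 0 ≤ x := fun x hx => spectrum_nonneg_of_nonneg hP hx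
  have hc1 : ContinuousOn (fun x : ℝ => (√(x + ε))⁻¹) (spectrum ℝ P) := by
    refine ContinuousOn.inv₀ (by fun_prop) fun x hx => ?_
    have := hsp x hx
    positivity
  have hc2 : ContinuousOn (fun x : ℝ => (x + ε)⁻¹) (spectrum ℝ P) := by
    refine ContinuousOn.inv₀ (by fun_prop) fun x hx => ?_
    have := hsp x hx
    positivity
  have hc3 : ContinuousOn (fun x : ℝ => x * x * (x + ε)⁻¹) (spectrum ℝ P) := by fun_prop
  have hadd : P + algebraMap ℝ A ε = cfc (fun x : ℝ => x + ε) P := by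
    rw [cfc_add_const ε (fun x : ℝ => x) P, cfc_id' ℝ P]
  have hPPR : P * P * cfc (fun x : ℝ => (x + ε)⁻¹) P = cfc (fun x : ℝ => x * x * (x + ε)⁻¹) P := by
    rw [cfc_mul (fun x : ℝ => x * x) (fun x : ℝ => (x + ε)⁻¹) P (by fun_prop) hc2,
      cfc_mul (fun x : ℝ => x) (fun x : ℝ => x) P, cfc_id' ℝ P]
  -- R = (P + ε)⁻¹ and T = R^(1/2). The two order bounds reduce to x²/(x + ε) ≤ x ≤ x²/(x + ε) + ε
  -- for x ≥ 0.
  refine ⟨cfc (fun x : ℝ => (x + ε)⁻¹) P, cfc (fun x : ℝ => (√(x + ε))⁻¹) P,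
    (cfc_predicate _ P : IsSelfAdjoint _).star_eq, ?_, ?_, ?_, ?_, ?_, ?_⟩
  · rw [← cfc_mul _ _ P hc1 hc1]
    refine cfc_congr fun x hx => ?_
    have := hsp x hx
    rw [← mul_inv, Real.mul_self_sqrt (by positivity)]
  · rw [hadd, ← cfc_mul _ _ P hc2 (by fun_prop), ← cfc_one ℝ P]
    refine cfc_congr fun x hx => ?_
    have := hsp x hx
    simp only [Pi.one_apply]
    exact inv_mul_cancel₀ (by positivity)
  · rw [hadd, ← cfc_mul _ _ P (by fun_prop) hc2, ← cfc_one ℝ P]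
    refine cfc_congr fun x hx => ?_
    have := hsp x hx
    simp only [Pi.one_apply]
    exact mul_inv_cancel₀ (by positivity)
  · have h := cfc_commute_cfc (fun x : ℝ => (√(x + ε))⁻¹) (fun x : ℝ => x) P
    rwa [cfc_id' ℝ P] at h
  · rw [hPPR]
    conv_rhs => rw [← cfc_id' ℝ P]
    refine cfc_mono (fun x hx => ?_) hc3 (by fun_prop)
    have := hsp x hx
    rw [← div_eq_mul_inv, div_le_iff₀ (by positivity)]
    nlinarith
  · rw [hPPR, ← cfc_add_const ε _ P hc3]
    conv_lhs => rw [← cfc_id' ℝ P]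
    refine cfc_mono (fun x hx => ?_) (by fun_prop) (hc3.add continuousOn_const)
    have := hsp x hx
    rw [← div_eq_mul_inv, div_add' _ _ _ (by positivity), le_div_iff₀ (by positivity)]
    nlinarith [mul_pos hε hε]

lemma etrace_mono {A B : H →L[ℂ] H} (h : A ≤ B) : etrace A ≤ etrace B := by
  refine ENNReal.tsum_le_tsum fun k => ENNReal.ofReal_le_ofReal ?_
  have := re_inner_nonneg (sub_nonneg.2 h) (someBasis H k)
  simpa [inner_sub_right] using this

/-- This replaces the polar decomposition. With T = (P + ε)^(-1/2), the intertwining CP = QC passes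
to resolvents, so (CT)†(CT) = P²/(P + ε) and (CT)(CT)† = Q²/(Q + ε) have equal traces. The second is
at most Q, and the first is within ε of P. -/
lemma etrace_sqrt_star_mul_le (C : H →L[ℂ] H) :
    etrace (CFC.sqrt (star C * C)) ≤ etrace (CFC.sqrt (C * star C)) := by
  set P := CFC.sqrt (star C * C) with hPdef
  set Q := CFC.sqrt (C * star C) with hQdef
  have hP : 0 ≤ P := CFC.sqrt_nonneg (star C * C)
  have hQ : 0 ≤ Q := CFC.sqrt_nonneg (C * star C)
  have hPC : P * P = star C * C := CFC.sqrt_mul_sqrt_self _ (star_mul_self_nonneg C)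
  have hQC : Q * Q = C * star C := CFC.sqrt_mul_sqrt_self _ (mul_star_self_nonneg C)
  have hCP : C * P = Q * C := modulus_intertwine hP hQ hPC hQC
  have hreg : ∀ ε : ℝ, 0 < ε → ∃ B : H →L[ℂ] H, etrace B ≤ etrace Q ∧
      P ≤ B + algebraMap ℝ (H →L[ℂ] H) ε := by
    intro ε hε
    obtain ⟨R, T, hT, hTT, hR1, hR2, hcomm, -, hle⟩ := exists_regularization hP hε
    obtain ⟨R', T', -, hTT', hR1', hR2', hcomm', hle', -⟩ := exists_regularization hQ hε
    have hCR : C * R = R' * C := by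
      have h1 : C * (P + algebraMap ℝ (H →L[ℂ] H) ε) = (Q + algebraMap ℝ (H →L[ℂ] H) ε) * C := by
        rw [mul_add, add_mul, hCP, Algebra.commutes ε C]
      calc C * R = R' * (Q + algebraMap ℝ (H →L[ℂ] H) ε) * C * R := by rw [hR1', one_mul]
        _ = R' * (C * (P + algebraMap ℝ (H →L[ℂ] H) ε)) * R := by rw [h1]; simp only [mul_assoc]
        _ = R' * C * ((P + algebraMap ℝ (H →L[ℂ] H) ε) * R) := by simp only [mul_assoc]
        _ = R' * C := by rw [hR2, mul_one]
    have h1 : star (C * T) * (C * T) = P * P * R := by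
      rw [star_mul, hT, mul_assoc, ← mul_assoc (star C), ← hPC, ← mul_assoc, ← mul_assoc,
        hcomm.eq, mul_assoc P, hcomm.eq, ← mul_assoc, mul_assoc, hTT]
    have h2 : C * T * star (C * T) = Q * Q * R' := by
      have hc : Commute R' Q := by rw [← hTT']; exact hcomm'.mul_left hcomm'
      rw [star_mul, hT, ← mul_assoc, mul_assoc C, hTT, hCR, mul_assoc, ← hQC,
        (hc.mul_right hc).eq]
    refine ⟨P * P * R, ?_, hle⟩
    rw [← h1, ← etrace_mul_star_self, h2]
    exact etrace_mono hle'
  -- The error ε·1 has infinite trace in infinite dimension, so only finite partial sums of the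
  -- diagonal are compared.
  have hdiag : ∀ ε : ℝ, 0 < ε → ∀ s : Finset _,
      ∑ k ∈ s, ENNReal.ofReal (⟪someBasis H k, P (someBasis H k)⟫_ℂ).re ≤
        etrace Q + s.card * ENNReal.ofReal ε := by
    intro ε hε s
    obtain ⟨B, hB, hPB⟩ := hreg ε hε
    calc ∑ k ∈ s, ENNReal.ofReal (⟪someBasis H k, P (someBasis H k)⟫_ℂ).re
        ≤ ∑ k ∈ s, (ENNReal.ofReal (⟪someBasis H k, B (someBasis H k)⟫_ℂ).re +
            ENNReal.ofReal ε) := by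
          refine Finset.sum_le_sum fun k _ => ?_
          refine (ENNReal.ofReal_le_ofReal ?_).trans ENNReal.ofReal_add_le
          have h := re_inner_nonneg (sub_nonneg.2 hPB) (someBasis H k)
          have h1 : ⟪someBasis H k, (algebraMap ℝ (H →L[ℂ] H) ε) (someBasis H k)⟫_ℂ = ε := by
            have h2 : (algebraMap ℝ (H →L[ℂ] H) ε) (someBasis H k) = (ε : ℂ) • someBasis H k := by
              rw [Algebra.algebraMap_eq_smul_one]
              simp
            rw [h2, inner_smul_right, inner_self_eq_norm_sq_to_K,
              (someBasis H).orthonormal.norm_eq_one]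
            simp
          rw [sub_apply, add_apply, inner_sub_right, inner_add_right, h1] at h
          simpa using h
      _ = ∑ k ∈ s, ENNReal.ofReal (⟪someBasis H k, B (someBasis H k)⟫_ℂ).re +
            s.card * ENNReal.ofReal ε := by
          rw [Finset.sum_add_distrib, Finset.sum_const, nsmul_eq_mul]
      _ ≤ etrace Q + s.card * ENNReal.ofReal ε := by
          gcongr
          exact (ENNReal.sum_le_tsum s).trans hB
  refine ENNReal.summable.tsum_le_of_sum_le fun s => ?_
  refine ENNReal.le_of_forall_pos_le_add fun δ hδ _ => ?_
  -- The summand 1 keeps the denominator positive when `s` is empty.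
  refine (hdiag (δ / (s.card + 1)) (by positivity) s).trans ?_
  gcongr
  rw [← ENNReal.ofReal_natCast, ← ENNReal.ofReal_mul (by positivity), ENNReal.ofReal_le_iff_le_toReal
    ENNReal.coe_ne_top, ENNReal.coe_toReal, mul_div_assoc', div_le_iff₀ (by positivity)]
  nlinarith [δ.coe_nonneg]

/-- The fidelity is symmetric. -/
theorem fidelity_comm {ρ σ : H →L[ℂ] H} (hρ : 0 ≤ ρ) (hσ : 0 ≤ σ) :
    fidelity ρ σ = fidelity σ ρ := by
  -- With C = √σ √ρ, the two fidelities are Tr|C| and Tr|C†|.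
  have h1 : CFC.sqrt ρ * σ * CFC.sqrt ρ =
      star (CFC.sqrt σ * CFC.sqrt ρ) * (CFC.sqrt σ * CFC.sqrt ρ) := by
    conv_lhs => rw [← CFC.sqrt_mul_sqrt_self σ hσ]
    simp only [star_mul, star_sqrt, mul_assoc]
  have h2 : CFC.sqrt σ * ρ * CFC.sqrt σ =
      CFC.sqrt σ * CFC.sqrt ρ * star (CFC.sqrt σ * CFC.sqrt ρ) := by
    conv_lhs => rw [← CFC.sqrt_mul_sqrt_self ρ hρ]
    simp only [star_mul, star_sqrt, mul_assoc]
  have h3 := etrace_sqrt_star_mul_le (star (CFC.sqrt σ * CFC.sqrt ρ))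
  rw [star_star] at h3
  rw [fidelity_eq, fidelity_eq, h1, h2, le_antisymm (etrace_sqrt_star_mul_le _) h3]

/-! ### Traces of products with a density operator -/

lemma summable_norm_sqrt_sq {I : Type*} (b : HilbertBasis I ℂ H) {ρ : H →L[ℂ] H}
    (hρ : IsDensityOperator ρ) : Summable fun i => ‖CFC.sqrt ρ (b i)‖ ^ 2 := by
  obtain ⟨h0, h1⟩ := isDensityOperator_iff.1 hρ
  rw [← star_sqrt_mul_sqrt h0, etrace_star_mul_self b] at h1
  have h := ENNReal.summable_toReal (h1.trans_ne ENNReal.one_ne_top)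
  refine h.congr fun i => ?_
  rw [ENNReal.toReal_ofReal (by positivity)]

/-- Cyclicity of the trace for Hilbert-Schmidt operators. -/
lemma tsum_inner_eq_tsum_inner_star {I J : Type*} (b : HilbertBasis I ℂ H)
    (c : HilbertBasis J ℂ H) (A B : H →L[ℂ] H)
    (hA : Summable fun j => ‖star A (c j)‖ ^ 2) (hB : Summable fun j => ‖star B (c j)‖ ^ 2) :
    ∑' i, ⟪A (b i), B (b i)⟫_ℂ = ∑' j, ⟪star B (c j), star A (c j)⟫_ℂ := by
  have hdouble : ∀ S : H →L[ℂ] H, (Summable fun j => ‖star S (c j)‖ ^ 2) →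
      Summable fun p : I × J => ‖⟪c p.2, S (b p.1)⟫_ℂ‖ ^ 2 := by
    intro S hS
    have h : ∑' p : J × I, ENNReal.ofReal (‖⟪c p.1, S (b p.2)⟫_ℂ‖ ^ 2) ≠ ⊤ := by
      rw [ENNReal.tsum_prod']
      have : ∀ j, ∑' i, ENNReal.ofReal (‖⟪c j, S (b i)⟫_ℂ‖ ^ 2) =
          ENNReal.ofReal (‖star S (c j)‖ ^ 2) := by
        intro j
        rw [← tsum_ofReal_norm_inner_sq b]
        refine tsum_congr fun i => ?_
        rw [star_eq_adjoint, adjoint_inner_right, norm_inner_symm]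
      simp_rw [this]
      rw [← ENNReal.ofReal_tsum_of_nonneg (fun _ => by positivity) hS]
      exact ENNReal.ofReal_ne_top
    have h2 := (ENNReal.summable_toReal h).comp_injective (Equiv.prodComm I J).injective
    refine h2.congr fun p => ?_
    simp only [Function.comp_apply, Equiv.prodComm_apply, Prod.fst_swap, Prod.snd_swap]
    rw [ENNReal.toReal_ofReal (by positivity)]
  have hsum : Summable fun p : I × J => ⟪A (b p.1), c p.2⟫_ℂ * ⟪c p.2, B (b p.1)⟫_ℂ := by
    refine Summable.of_norm_bounded ((hdouble A hA).add (hdouble B hB)) fun p => ?_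
    rw [norm_mul, norm_inner_symm]
    nlinarith [sq_nonneg (‖⟪c p.2, A (b p.1)⟫_ℂ‖ - ‖⟪c p.2, B (b p.1)⟫_ℂ‖),
      norm_nonneg ⟪c p.2, A (b p.1)⟫_ℂ, norm_nonneg ⟪c p.2, B (b p.1)⟫_ℂ]
  have hI : ∀ i, ⟪A (b i), B (b i)⟫_ℂ = ∑' j, ⟪A (b i), c j⟫_ℂ * ⟪c j, B (b i)⟫_ℂ := fun i =>
    (c.tsum_inner_mul_inner _ _).symm
  have hJ : ∀ j, ⟪star B (c j), star A (c j)⟫_ℂ =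
      ∑' i, ⟪A (b i), c j⟫_ℂ * ⟪c j, B (b i)⟫_ℂ := by
    intro j
    rw [← b.tsum_inner_mul_inner]
    refine tsum_congr fun i => ?_
    rw [star_eq_adjoint, star_eq_adjoint, adjoint_inner_left, adjoint_inner_right, mul_comm]
  simp_rw [hI, hJ]
  exact hsum.prod_symm.tsum_comm

/-- Tr(ρX) = Tr(√ρ X √ρ), computed in any basis: √ρ and √ρ X are Hilbert-Schmidt because ρ has trace
one. -/
lemma trace_mul_eq_tsum {J : Type*} (c : HilbertBasis J ℂ H) {ρ : H →L[ℂ] H}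
    (hρ : IsDensityOperator ρ) (X : H →L[ℂ] H) :
    trace (ρ * X) = ∑' j, ⟪CFC.sqrt ρ (c j), X (CFC.sqrt ρ (c j))⟫_ℂ := by
  obtain ⟨h0, -⟩ := isDensityOperator_iff.1 hρ
  have hS := summable_norm_sqrt_sq c hρ
  have h := tsum_inner_eq_tsum_inner_star (someBasis H) c (CFC.sqrt ρ) (CFC.sqrt ρ * X)
    (by rwa [star_sqrt]) (by
      refine Summable.of_nonneg_of_le (fun _ => by positivity) (fun j => ?_)
        (hS.mul_left (‖star X‖ ^ 2))
      rw [star_mul, star_sqrt, mul_apply_eq_comp, ← mul_pow]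
      gcongr
      exact le_opNorm _ _)
  rw [star_mul, star_sqrt] at h
  have h1 : trace (ρ * X) =
      ∑' i, ⟪CFC.sqrt ρ (someBasis H i), (CFC.sqrt ρ * X) (someBasis H i)⟫_ℂ := by
    unfold trace
    refine tsum_congr fun i => ?_
    conv_lhs => rw [← star_sqrt_mul_sqrt h0]
    rw [mul_assoc, mul_apply_eq_comp, star_eq_adjoint, adjoint_inner_right]
  rw [h1, h]
  refine tsum_congr fun j => ?_
  rw [mul_apply_eq_comp, star_eq_adjoint, adjoint_inner_left]

/-- A density operator is a series of rank-one operators. -/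
lemma IsDensityOperator.exists_tsum_rankOne {J : Type*} (b : HilbertBasis J ℂ H)
    {ρ : H →L[ℂ] H} (hρ : IsDensityOperator ρ) :
    ∃ f : J → H, (Summable fun j => ‖f j‖ ^ 2) ∧
      (∀ X : H →L[ℂ] H, trace (ρ * X) = ∑' j, ⟪f j, X (f j)⟫_ℂ) ∧
      ∀ φ ψ : H, ⟪φ, ρ ψ⟫_ℂ = ∑' j, ⟪φ, f j⟫_ℂ * ⟪f j, ψ⟫_ℂ := by
  refine ⟨fun j => CFC.sqrt ρ (b j), summable_norm_sqrt_sq b hρ, trace_mul_eq_tsum b hρ,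
    fun φ ψ => ?_⟩
  obtain ⟨h0, -⟩ := isDensityOperator_iff.1 hρ
  have hsym : ∀ x y, ⟪CFC.sqrt ρ x, y⟫_ℂ = ⟪x, CFC.sqrt ρ y⟫_ℂ := by
    intro x y
    conv_lhs => rw [← star_sqrt, star_eq_adjoint, adjoint_inner_left]
  conv_lhs => rw [← CFC.sqrt_mul_sqrt_self ρ h0, mul_apply_eq_comp, ← hsym,
    ← b.tsum_inner_mul_inner]
  refine tsum_congr fun k => ?_
  rw [hsym, hsym]

/-! ### Unitary conjugation -/

lemma sqrt_unitary_conj {U : H →L[ℂ] H} (hU : star U * U = 1) {A : H →L[ℂ] H} (hA : 0 ≤ A) :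
    CFC.sqrt (U * A * star U) = U * CFC.sqrt A * star U := by
  refine CFC.sqrt_unique ?_ (star_right_conjugate_nonneg (CFC.sqrt_nonneg A) U)
  calc U * CFC.sqrt A * star U * (U * CFC.sqrt A * star U)
      = U * CFC.sqrt A * (star U * U) * CFC.sqrt A * star U := by simp only [mul_assoc]
    _ = U * (CFC.sqrt A * CFC.sqrt A) * star U := by rw [hU, mul_one]; simp only [mul_assoc]
    _ = U * A * star U := by rw [CFC.sqrt_mul_sqrt_self A hA]

lemma etrace_unitary_conj {U : H →L[ℂ] H} (hU : star U * U = 1) {A : H →L[ℂ] H} (hA : 0 ≤ A) :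
    etrace (U * A * star U) = etrace A := by
  have h : U * A * star U = star (CFC.sqrt A * star U) * (CFC.sqrt A * star U) := by
    conv_lhs => rw [← star_sqrt_mul_sqrt hA]
    simp only [star_mul, star_star, mul_assoc]
  have h2 : CFC.sqrt A * star U * star (CFC.sqrt A * star U) = A := by
    rw [star_mul, star_star, mul_assoc, ← mul_assoc (star U), hU, one_mul, star_sqrt,
      CFC.sqrt_mul_sqrt_self A hA]
  rw [h, ← etrace_mul_star_self, h2]

lemma fidelity_unitary_conj {U : H →L[ℂ] H} (hU : star U * U = 1) {ρ σ : H →L[ℂ] H}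
    (hρ : 0 ≤ ρ) (hσ : 0 ≤ σ) :
    fidelity (U * ρ * star U) (U * σ * star U) = fidelity ρ σ := by
  have hpos : 0 ≤ CFC.sqrt ρ * σ * CFC.sqrt ρ := by
    have := star_left_conjugate_nonneg hσ (CFC.sqrt ρ)
    rwa [star_sqrt] at this
  have h : U * CFC.sqrt ρ * star U * (U * σ * star U) * (U * CFC.sqrt ρ * star U) =
      U * (CFC.sqrt ρ * σ * CFC.sqrt ρ) * star U := by
    calc _ = U * CFC.sqrt ρ * (star U * U) * σ * (star U * U) * CFC.sqrt ρ * star U := by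
          simp only [mul_assoc]
      _ = _ := by rw [hU]; simp only [mul_assoc, one_mul]
  rw [fidelity_eq, fidelity_eq, sqrt_unitary_conj hU hρ, h, sqrt_unitary_conj hU hpos,
    etrace_unitary_conj hU (CFC.sqrt_nonneg _)]

lemma isDensityOperator_unitary_conj {U : H →L[ℂ] H} (hU : star U * U = 1) {ρ : H →L[ℂ] H}
    (hρ : IsDensityOperator ρ) : IsDensityOperator (U * ρ * star U) := by
  obtain ⟨h0, h1⟩ := isDensityOperator_iff.1 hρ
  exact isDensityOperator_iff.2
    ⟨star_right_conjugate_nonneg h0 U, (etrace_unitary_conj hU h0).trans h1⟩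

/-- UρU†X factors as (√ρ U†)†(√ρ U†X), a product of Hilbert-Schmidt operators, so the cyclicity
above applies. -/
lemma trace_unitary_conj_mul (U : H →L[ℂ] H) {ρ : H →L[ℂ] H}
    (hρ : IsDensityOperator ρ) (X : H →L[ℂ] H) :
    trace (U * ρ * star U * X) = trace (ρ * (star U * X * U)) := by
  obtain ⟨h0, -⟩ := isDensityOperator_iff.1 hρ
  have hS := summable_norm_sqrt_sq (someBasis H) hρ
  have hX : ∀ Y : H →L[ℂ] H, Summable fun j => ‖Y (CFC.sqrt ρ (someBasis H j))‖ ^ 2 := by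
    intro Y
    refine Summable.of_nonneg_of_le (fun _ => by positivity) (fun j => ?_)
      (hS.mul_left (‖Y‖ ^ 2))
    rw [← mul_pow]
    gcongr
    exact le_opNorm _ _
  have h := tsum_inner_eq_tsum_inner_star (someBasis H) (someBasis H) (CFC.sqrt ρ * star U)
    (CFC.sqrt ρ * star U * X) (by simpa [star_sqrt] using hX U)
    (by simpa [star_sqrt] using hX (star X * U))
  rw [trace_mul_eq_tsum (someBasis H) hρ]
  unfold trace
  have h1 : ∀ i, ⟪someBasis H i, (U * ρ * star U * X) (someBasis H i)⟫_ℂ =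
      ⟪(CFC.sqrt ρ * star U) (someBasis H i), (CFC.sqrt ρ * star U * X) (someBasis H i)⟫_ℂ := by
    intro i
    have h2 : U * ρ * star U * X = star (CFC.sqrt ρ * star U) * (CFC.sqrt ρ * star U * X) := by
      conv_lhs => rw [← star_sqrt_mul_sqrt h0]
      simp only [star_mul, star_star, mul_assoc]
    rw [h2, mul_apply_eq_comp (star _), star_eq_adjoint (_ * _), adjoint_inner_right]
  simp_rw [h1]
  rw [h]
  refine tsum_congr fun j => ?_
  simp only [star_mul, star_star, star_sqrt, mul_apply_eq_comp]
  rw [star_eq_adjoint, star_eq_adjoint, adjoint_inner_left, adjoint_inner_right]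

end PositiveTrace

/-! ## Uniqueness of Fourier transforms of integrable functions -/

section Fourier

open scoped ENNReal

variable {ι : Type*} [Fintype ι]

/-- The positive and negative parts of g are densities of two finite measures. A vanishing Fourier
transform says that their characteristic functions agree, so the measures and then the densities
coincide. -/
lemma ae_eq_zero_of_real_fourier_eq_zero {g : (ι → ℝ) → ℝ} (hg : Integrable g)
    (h : ∀ s : ι → ℝ, ∫ q, Complex.exp (((∑ j, s j * q j : ℝ) : ℂ) * Complex.I) * (g q : ℂ) = 0) :
    g =ᵐ[volume] 0 := by
  classical
  set μ := (volume : Measure (ι → ℝ)).withDensity fun q => ENNReal.ofReal (g q) with hμ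
  set ν := (volume : Measure (ι → ℝ)).withDensity fun q => ENNReal.ofReal (-g q) with hν
  have hfin : ∫⁻ q, ENNReal.ofReal (g q) ≠ ∞ := hg.lintegral_lt_top.ne
  have hfin' : ∫⁻ q, ENNReal.ofReal (-g q) ≠ ∞ := hg.neg.lintegral_lt_top.ne
  have : IsFiniteMeasure μ := isFiniteMeasure_withDensity hfin
  have : IsFiniteMeasure ν := isFiniteMeasure_withDensity hfin'
  have hm : AEMeasurable (fun q => ENNReal.ofReal (g q)) (volume : Measure (ι → ℝ)) :=
    hg.1.aemeasurable.ennreal_ofReal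
  have hm' : AEMeasurable (fun q => ENNReal.ofReal (-g q)) (volume : Measure (ι → ℝ)) :=
    hg.1.aemeasurable.neg.ennreal_ofReal
  have hμν : μ = ν := by
    refine Measure.ext_of_charFunDual ?_
    ext L
    set s : ι → ℝ := fun j => L (Pi.single j 1) with hs
    have hL : ∀ q, L q = ∑ j, s j * q j := by
      intro q
      conv_lhs => rw [← Finset.univ_sum_single q, map_sum]
      refine Finset.sum_congr rfl fun j _ => ?_
      have : Pi.single j (q j) = q j • (Pi.single j 1 : ι → ℝ) := by
        rw [← Pi.single_smul, smul_eq_mul, mul_one]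
      rw [this, map_smul, smul_eq_mul, mul_comm]
    rw [charFunDual_apply, charFunDual_apply, hμ, hν,
      integral_withDensity_eq_integral_toReal_smul₀ hm (by simp),
      integral_withDensity_eq_integral_toReal_smul₀ hm' (by simp), ← sub_eq_zero,
      ← integral_sub, ← h s]
    · refine integral_congr_ae (Filter.Eventually.of_forall fun q => ?_)
      simp only [hL]
      rw [← sub_smul, ENNReal.toReal_ofReal', ENNReal.toReal_ofReal', max_zero_sub_eq_self,
        Complex.real_smul, mul_comm]
    · refine Integrable.mono hg (AEStronglyMeasurable.smul (f := fun q => (ENNReal.ofReal (g q)).toReal)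
        hm.ennreal_toReal.aestronglyMeasurable
        (by fun_prop : Continuous _).aestronglyMeasurable) (Filter.Eventually.of_forall fun q => ?_)
      rw [norm_smul, Complex.norm_exp_ofReal_mul_I, mul_one, ENNReal.toReal_ofReal']
      simp only [Real.norm_eq_abs]
      rw [abs_of_nonneg (le_max_right _ _)]
      exact max_le (le_abs_self _) (abs_nonneg _)
    · refine Integrable.mono hg (AEStronglyMeasurable.smul (f := fun q => (ENNReal.ofReal (-g q)).toReal)
        hm'.ennreal_toReal.aestronglyMeasurable
        (by fun_prop : Continuous _).aestronglyMeasurable) (Filter.Eventually.of_forall fun q => ?_)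
      rw [norm_smul, Complex.norm_exp_ofReal_mul_I, mul_one, ENNReal.toReal_ofReal']
      simp only [Real.norm_eq_abs]
      rw [abs_of_nonneg (le_max_right _ _)]
      exact max_le (neg_le_abs _) (abs_nonneg _)
  filter_upwards [(withDensity_eq_iff hm hm' hfin).1 hμν] with q hq
  have h1 := congrArg ENNReal.toReal hq
  rw [ENNReal.toReal_ofReal', ENNReal.toReal_ofReal'] at h1
  rw [← max_zero_sub_eq_self (g q), h1, sub_self, Pi.zero_apply]

/-- An integrable function whose Fourier transform vanishes is zero. -/
lemma ae_eq_zero_of_fourier_eq_zero {f : (ι → ℝ) → ℂ} (hf : Integrable f)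
    (h : ∀ s : ι → ℝ, ∫ q, Complex.exp (((∑ j, s j * q j : ℝ) : ℂ) * Complex.I) * f q = 0) :
    f =ᵐ[volume] 0 := by
  have hint : ∀ (s : ι → ℝ) {f : (ι → ℝ) → ℂ}, Integrable f → Integrable fun q =>
      Complex.exp (((∑ j, s j * q j : ℝ) : ℂ) * Complex.I) * f q := by
    intro s f hf
    refine Integrable.mono hf (AEStronglyMeasurable.mul
      (by fun_prop : Continuous _).aestronglyMeasurable hf.1)
      (Filter.Eventually.of_forall fun q => ?_)
    rw [norm_mul, Complex.norm_exp_ofReal_mul_I, one_mul]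
  have hre : ∀ {f : (ι → ℝ) → ℂ}, Integrable f → (∀ s : ι → ℝ,
      ∫ q, Complex.exp (((∑ j, s j * q j : ℝ) : ℂ) * Complex.I) * f q = 0) →
      (fun q => (f q).re) =ᵐ[volume] 0 := by
    intro f hf h
    refine ae_eq_zero_of_real_fourier_eq_zero hf.re fun s => ?_
    -- Conjugating the hypothesis at -s shows that the conjugate of f also has vanishing Fourier
    -- transform, hence so does Re f. The imaginary part is the real part of -i f.
    have hconj : ∫ q, Complex.exp (((∑ j, s j * q j : ℝ) : ℂ) * Complex.I) *
        (starRingEnd ℂ) (f q) = 0 := by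
      have h1 := congrArg (starRingEnd ℂ) (h (-s))
      rw [← integral_conj, map_zero] at h1
      rw [← h1]
      refine integral_congr_ae (Filter.Eventually.of_forall fun q => ?_)
      simp only [map_mul, ← Complex.exp_conj, Complex.conj_ofReal, Complex.conj_I, Pi.neg_apply,
        neg_mul, Finset.sum_neg_distrib, Complex.ofReal_neg, map_neg, mul_neg, neg_neg]
    have h2 : ∀ q, Complex.exp (((∑ j, s j * q j : ℝ) : ℂ) * Complex.I) * ((f q).re : ℂ) =
        (Complex.exp (((∑ j, s j * q j : ℝ) : ℂ) * Complex.I) * f q +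
          Complex.exp (((∑ j, s j * q j : ℝ) : ℂ) * Complex.I) * (starRingEnd ℂ) (f q)) / 2 := by
      intro q
      rw [← mul_add, Complex.add_conj]
      push_cast
      ring
    have hfc : Integrable fun q => (starRingEnd ℂ) (f q) :=
      hf.mono (Complex.continuous_conj.comp_aestronglyMeasurable hf.1) (by simp)
    simp_rw [h2]
    rw [integral_div, integral_add (hint s hf) (hint s hfc), h s, hconj]
    simp
  have h1 := hre hf h
  have h2 := hre (hf.const_mul (-Complex.I)) fun s => by
    have : ∀ q, Complex.exp (((∑ j, s j * q j : ℝ) : ℂ) * Complex.I) * (-Complex.I * f q) =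
        -Complex.I * (Complex.exp (((∑ j, s j * q j : ℝ) : ℂ) * Complex.I) * f q) := by
      intro q; ring
    simp_rw [this]
    rw [integral_const_mul, h s, mul_zero]
  filter_upwards [h1, h2] with q hq1 hq2
  refine Complex.ext (by simpa using hq1) (by simpa using hq2)

lemma integrable_tsum_of_summable_integral_norm {α K : Type*} [MeasurableSpace α] {μ : Measure α}
    [Countable K] {F : K → α → ℂ} (hF : ∀ k, Integrable (F k) μ)
    (hs : Summable fun k => ∫ a, ‖F k a‖ ∂μ) : Integrable (fun a => ∑' k, F k a) μ := by
  refine ⟨AEStronglyMeasurable.tsum fun k => (hF k).1, ?_⟩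
  have h1 : ∫⁻ a, ∑' k, ‖F k a‖ₑ ∂μ < ∞ := by
    rw [lintegral_tsum fun k => (hF k).1.enorm]
    have : ∀ k, ∫⁻ a, ‖F k a‖ₑ ∂μ = ENNReal.ofReal (∫ a, ‖F k a‖ ∂μ) := fun k =>
      (ofReal_integral_norm_eq_lintegral_enorm (hF k)).symm
    simp_rw [this]
    rw [← ENNReal.ofReal_tsum_of_nonneg (fun k => integral_nonneg fun _ => norm_nonneg _) hs]
    exact ENNReal.ofReal_lt_top
  refine lt_of_le_of_lt (lintegral_mono fun a => ?_) h1
  by_cases hsum : ∑' k, ‖F k a‖ₑ = ∞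
  · rw [hsum]; exact le_top
  · exact enorm_tsum_le_tsum_enorm

end Fourier

/-! ## A density operator is determined by its characteristic function -/

section CharacteristicFunction

open ContinuousLinearMap

variable {ι : Type*} [Fintype ι]

lemma integrable_conj_mul (f g : ModeSpace ι) :
    Integrable fun q => (starRingEnd ℂ) (f q) * g q := by
  have h := L2.integrable_inner (𝕜 := ℂ) f g
  refine h.congr (Filter.Eventually.of_forall fun q => ?_)
  simp [RCLike.inner_apply, mul_comm]

lemma inner_eq_integral (f g : ModeSpace ι) :
    ⟪f, g⟫_ℂ = ∫ q, (starRingEnd ℂ) (f q) * g q := by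
  rw [L2.inner_def]
  refine integral_congr_ae (Filter.Eventually.of_forall fun q => ?_)
  simp [RCLike.inner_apply, mul_comm]

lemma integrable_norm_sq (f : ModeSpace ι) : Integrable fun q => ‖f q‖ ^ 2 :=
  (Lp.memLp f).integrable_norm_pow (by norm_num)

lemma integral_norm_sq (f : ModeSpace ι) : ∫ q, ‖f q‖ ^ 2 = ‖f‖ ^ 2 := by
  have h := inner_eq_integral f f
  rw [inner_self_eq_norm_sq_to_K] at h
  have h2 : ∀ q, (starRingEnd ℂ) (f q) * f q = ((‖f q‖ ^ 2 : ℝ) : ℂ) := by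
    intro q
    rw [Complex.conj_mul']
    push_cast
    rfl
  simp_rw [h2] at h
  rw [integral_complex_ofReal] at h
  refine Complex.ofReal_injective (h.symm.trans ?_)
  rw [Complex.ofReal_pow]
  rfl

lemma integral_norm_mul_norm_le (f g : ModeSpace ι) :
    ∫ q, ‖f q‖ * ‖g q‖ ≤ ‖f‖ * ‖g‖ := by
  have h2 := integral_mul_le_Lp_mul_Lq_of_nonneg (μ := (volume : Measure (ι → ℝ)))
    (p := 2) (q := 2) Real.HolderConjugate.two_two (f := fun q => ‖f q‖) (g := fun q => ‖g q‖)
    (Filter.Eventually.of_forall fun _ => norm_nonneg _)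
    (Filter.Eventually.of_forall fun _ => norm_nonneg _)
    (by simpa using (Lp.memLp f).norm) (by simpa using (Lp.memLp g).norm)
  refine h2.trans_eq ?_
  have h3 : ∀ f : ModeSpace ι, (∫ q, ‖f q‖ ^ (2 : ℝ)) ^ (1 / (2 : ℝ)) = ‖f‖ := by
    intro f
    simp_rw [Real.rpow_two]
    rw [integral_norm_sq, ← Real.sqrt_eq_rpow, Real.sqrt_sq (norm_nonneg _)]
  rw [h3, h3]

/-- The integral kernel of `∑ₖ |fₖ⟩⟨fₖ|` (first variable conjugated). -/
noncomputable def kernel {K : Type*} (f : K → ModeSpace ι) (q y : ι → ℝ) : ℂ :=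
  ∑' k, (starRingEnd ℂ) (f k q) * f k y

lemma measurable_kernel {K : Type*} [Countable K] (f : K → ModeSpace ι) :
    Measurable fun p : (ι → ℝ) × (ι → ℝ) => kernel f p.1 p.2 := by
  unfold kernel
  refine Measurable.tsum fun k => ?_
  have h : Measurable (f k : (ι → ℝ) → ℂ) := (Lp.stronglyMeasurable (f k)).measurable
  exact ((Complex.continuous_conj.measurable.comp h).comp measurable_fst).mul
    (h.comp measurable_snd)

lemma translate_ae (t : ι → ℝ) (ψ : ModeSpace ι) :
    (translate t ψ : (ι → ℝ) → ℂ) =ᵐ[volume] fun q => ψ (q + t) :=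
  Lp.coeFn_compMeasurePreserving ψ (measurePreserving_add_right (volume : Measure (ι → ℝ)) t)

lemma norm_translate (t : ι → ℝ) (ψ : ModeSpace ι) : ‖translate t ψ‖ = ‖ψ‖ :=
  (Lp.compMeasurePreservingₗᵢ ℂ (fun q : ι → ℝ => q + t)
    (measurePreserving_add_right volume t)).norm_map ψ

/-- By Cauchy-Schwarz and translation invariance the k-th summand has L¹ norm at most ‖f k‖², so the
series may be integrated term by term. -/
lemma integrable_kernel_translate {K : Type*} [Countable K] {f : K → ModeSpace ι}
    (hf : Summable fun k => ‖f k‖ ^ 2) (ξ : ι × Fin 2 → ℝ) :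
    Integrable (fun q => kernel f q (q + fun j => ξ (j, 1))) ∧
      ∑' k, ⟪f k, weyl ξ (f k)⟫_ℂ = ∫ q, weylPhase (fun j => ξ (j, 0)) (fun j => ξ (j, 1)) q *
        kernel f q (q + fun j => ξ (j, 1)) := by
  set s : ι → ℝ := fun j => ξ (j, 0)
  set t : ι → ℝ := fun j => ξ (j, 1)
  have hae : ∀ k, (fun q => (starRingEnd ℂ) (f k q) * translate t (f k) q) =ᵐ[volume]
      fun q => (starRingEnd ℂ) (f k q) * f k (q + t) := fun k => by
    filter_upwards [translate_ae t (f k)] with q hq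
    rw [hq]
  have hI : ∀ k, Integrable fun q => (starRingEnd ℂ) (f k q) * f k (q + t) := fun k =>
    (integrable_conj_mul (f k) (translate t (f k))).congr (hae k)
  have hnorm : ∀ k, ∫ q, ‖(starRingEnd ℂ) (f k q) * f k (q + t)‖ ≤ ‖f k‖ ^ 2 := by
    intro k
    have h := integral_norm_mul_norm_le (f k) (translate t (f k))
    rw [norm_translate, ← sq] at h
    refine le_trans (le_of_eq (integral_congr_ae ?_)) h
    filter_upwards [hae k] with q hq
    rw [← hq]
    simp
  have hs : Summable fun k => ∫ q, ‖(starRingEnd ℂ) (f k q) * f k (q + t)‖ :=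
    Summable.of_nonneg_of_le (fun k => integral_nonneg fun _ => norm_nonneg _) hnorm hf
  refine ⟨integrable_tsum_of_summable_integral_norm hI hs, ?_⟩
  have hI2 : ∀ k, Integrable fun q => weylPhase s t q * ((starRingEnd ℂ) (f k q) * f k (q + t)) :=
    fun k => (hI k).mono ((continuous_weylPhase s t).aestronglyMeasurable.mul (hI k).1)
      (Filter.Eventually.of_forall fun q => by rw [norm_mul, norm_weylPhase, one_mul])
  have hs2 : Summable fun k => ∫ q, ‖weylPhase s t q * ((starRingEnd ℂ) (f k q) * f k (q + t))‖ := by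
    refine hs.congr fun k => ?_
    simp_rw [norm_mul (weylPhase s t _), norm_weylPhase, one_mul]
  have h := hasSum_integral_of_summable_integral_norm hI2 hs2
  have h3 : ∀ k, ⟪f k, weyl ξ (f k)⟫_ℂ =
      ∫ q, weylPhase s t q * ((starRingEnd ℂ) (f k q) * f k (q + t)) := by
    intro k
    rw [inner_eq_integral]
    refine integral_congr_ae ?_
    filter_upwards [weyl_apply_ae ξ (f k)] with q hq
    rw [hq]
    ring
  simp_rw [h3]
  rw [h.tsum_eq]
  refine integral_congr_ae (Filter.Eventually.of_forall fun q => ?_)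
  simp only [kernel]
  rw [tsum_mul_left]

/-- For fixed t, Fourier uniqueness in s gives equality of the kernels at (q, q + t) for almost
every q. Fubini turns this into equality at almost every y = q + t, for almost every q. -/
lemma ae_kernel_eq {K K' : Type*} [Countable K] [Countable K'] {f : K → ModeSpace ι}
    {g : K' → ModeSpace ι} (hf : Summable fun k => ‖f k‖ ^ 2) (hg : Summable fun k => ‖g k‖ ^ 2)
    (h : ∀ ξ : ι × Fin 2 → ℝ, ∑' k, ⟪f k, weyl ξ (f k)⟫_ℂ = ∑' k, ⟪g k, weyl ξ (g k)⟫_ℂ) :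
    ∀ᵐ q : ι → ℝ, ∀ᵐ y : ι → ℝ, kernel f q y = kernel g q y := by
  have h1 : ∀ t : ι → ℝ, ∀ᵐ q : ι → ℝ, kernel f q (q + t) = kernel g q (q + t) := by
    intro t
    have hfi := fun s : ι → ℝ => integrable_kernel_translate hf
      (fun p : ι × Fin 2 => if p.2 = 0 then s p.1 else t p.1)
    have hgi := fun s : ι → ℝ => integrable_kernel_translate hg
      (fun p : ι × Fin 2 => if p.2 = 0 then s p.1 else t p.1)
    simp only [one_ne_zero, if_true, if_false] at hfi hgi
    have h2 := ae_eq_zero_of_fourier_eq_zero ((hfi 0).1.sub (hgi 0).1) fun s => ?_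
    · filter_upwards [h2] with q hq
      exact sub_eq_zero.1 hq
    have h3 := (hfi s).2
    rw [h, (hgi s).2] at h3
    have hI : ∀ {u : (ι → ℝ) → ℂ}, Integrable u → Integrable fun q => weylPhase s t q * u q :=
      fun hu => hu.mono ((continuous_weylPhase s t).aestronglyMeasurable.mul hu.1)
        (Filter.Eventually.of_forall fun q => by rw [norm_mul, norm_weylPhase, one_mul])
    have h4 : ∫ q, weylPhase s t q * (kernel f q (q + t) - kernel g q (q + t)) = 0 := by
      simp_rw [mul_sub]
      rw [integral_sub (hI (hfi 0).1) (hI (hgi 0).1), ← h3, sub_self]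
    -- The Weyl phase differs from exp(i s·q) only by a factor independent of q.
    have h5 : ∀ q, Complex.exp (((∑ j, s j * q j : ℝ) : ℂ) * Complex.I) =
        Complex.exp (-(((∑ j, s j * t j) / 2 : ℝ) : ℂ) * Complex.I) * weylPhase s t q := by
      intro q
      rw [weylPhase, ← Complex.exp_add]
      congr 1
      push_cast
      ring
    simp only [Pi.sub_apply, h5, mul_assoc]
    rw [integral_const_mul, h4, mul_zero]
  -- Exchanging the two almost-everywhere quantifiers requires joint measurability in (t, q).
  have hset : MeasurableSet {p : (ι → ℝ) × (ι → ℝ) | kernel f p.2 (p.2 + p.1) =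
      kernel g p.2 (p.2 + p.1)} := by
    have hm : Measurable fun p : (ι → ℝ) × (ι → ℝ) => (p.2, p.2 + p.1) := by fun_prop
    exact measurableSet_eq_fun ((measurable_kernel f).comp hm) ((measurable_kernel g).comp hm)
  have h2 := (Measure.ae_ae_comm (μ := volume) (ν := volume) hset).1 (Filter.Eventually.of_forall h1)
  filter_upwards [h2] with q hq
  have hmp := measurePreserving_add_right (volume : Measure (ι → ℝ)) (-q)
  filter_upwards [hmp.quasiMeasurePreserving.ae hq] with y hy
  simpa using hy

lemma ae_summable_norm_sq {K : Type*} [Countable K] {f : K → ModeSpace ι}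
    (hf : Summable fun k => ‖f k‖ ^ 2) : ∀ᵐ q : ι → ℝ, Summable fun k => ‖f k q‖ ^ 2 := by
  have h := summable_norm_of_tsum_eLpNorm_ne_top (μ := (volume : Measure (ι → ℝ)))
    (p := 1) le_rfl (f := fun k q => ‖f k q‖ ^ 2) (fun k => (integrable_norm_sq (f k)).1) ?_
  · filter_upwards [h] with q hq
    simpa using hq
  · have : ∀ k, eLpNorm (fun q => ‖f k q‖ ^ 2) 1 (volume : Measure (ι → ℝ)) =
        ENNReal.ofReal (‖f k‖ ^ 2) := by
      intro k
      rw [eLpNorm_one_eq_lintegral_enorm,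
        ← ofReal_integral_norm_eq_lintegral_enorm (integrable_norm_sq (f k)), ← integral_norm_sq]
      simp
    simp_rw [this]
    rw [← ENNReal.ofReal_tsum_of_nonneg (fun _ => by positivity) hf]
    exact ENNReal.ofReal_ne_top

/-- All matrix elements of the operator are read off from its kernel. The exchange of sum and
integral in q follows from Σ‖f k‖² < ∞; the one in y also needs Σ|f k q|² < ∞, which holds for
almost every q. -/
lemma tsum_inner_mul_inner_eq_integral_kernel {K : Type*} [Countable K] {f : K → ModeSpace ι}
    (hf : Summable fun k => ‖f k‖ ^ 2) (φ ψ : ModeSpace ι) :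
    ∑' k, ⟪φ, f k⟫_ℂ * ⟪f k, ψ⟫_ℂ =
      ∫ q, ψ q * ∫ y, (starRingEnd ℂ) (φ y) * kernel f q y := by
  have hI : ∀ k, Integrable fun q => ψ q * ((starRingEnd ℂ) (f k q) * ⟪φ, f k⟫_ℂ) := fun k =>
    ((integrable_conj_mul (f k) ψ).mul_const ⟪φ, f k⟫_ℂ).congr
      (Filter.Eventually.of_forall fun q => by ring)
  have hs : Summable fun k => ∫ q, ‖ψ q * ((starRingEnd ℂ) (f k q) * ⟪φ, f k⟫_ℂ)‖ := by
    refine Summable.of_nonneg_of_le (fun k => integral_nonneg fun _ => norm_nonneg _)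
      (fun k => ?_) (hf.mul_left (‖ψ‖ * ‖φ‖))
    have h1 : ∀ q, ‖ψ q * ((starRingEnd ℂ) (f k q) * ⟪φ, f k⟫_ℂ)‖ =
        ‖ψ q‖ * ‖f k q‖ * ‖⟪φ, f k⟫_ℂ‖ := by
      intro q
      simp [mul_assoc]
    simp_rw [h1]
    rw [integral_mul_const]
    calc (∫ q, ‖ψ q‖ * ‖f k q‖) * ‖⟪φ, f k⟫_ℂ‖ ≤ (‖ψ‖ * ‖f k‖) * (‖φ‖ * ‖f k‖) := by
          gcongr
          · exact integral_norm_mul_norm_le ψ (f k)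
          · exact norm_inner_le_norm _ _
      _ = ‖ψ‖ * ‖φ‖ * ‖f k‖ ^ 2 := by ring
  have h := hasSum_integral_of_summable_integral_norm hI hs
  have h2 : ∀ k, ⟪φ, f k⟫_ℂ * ⟪f k, ψ⟫_ℂ =
      ∫ q, ψ q * ((starRingEnd ℂ) (f k q) * ⟪φ, f k⟫_ℂ) := by
    intro k
    rw [inner_eq_integral (f k) ψ, ← integral_const_mul]
    exact integral_congr_ae (Filter.Eventually.of_forall fun q => by ring)
  simp_rw [h2]
  rw [h.tsum_eq]
  refine integral_congr_ae ?_
  filter_upwards [ae_summable_norm_sq hf] with q hq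
  rw [tsum_mul_left]
  congr 1
  have hI' : ∀ k, Integrable fun y => (starRingEnd ℂ) (φ y) *
      ((starRingEnd ℂ) (f k q) * f k y) := fun k =>
    ((integrable_conj_mul φ (f k)).mul_const ((starRingEnd ℂ) (f k q))).congr
      (Filter.Eventually.of_forall fun y => by ring)
  have hs' : Summable fun k => ∫ y, ‖(starRingEnd ℂ) (φ y) *
      ((starRingEnd ℂ) (f k q) * f k y)‖ := by
    refine Summable.of_nonneg_of_le (fun k => integral_nonneg fun _ => norm_nonneg _)
      (fun k => ?_) ((hq.add hf).mul_left ‖φ‖)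
    have h1 : ∀ y, ‖(starRingEnd ℂ) (φ y) * ((starRingEnd ℂ) (f k q) * f k y)‖ =
        ‖f k q‖ * (‖φ y‖ * ‖f k y‖) := by
      intro y
      simp only [norm_mul, RCLike.norm_conj]
      ring
    simp_rw [h1]
    rw [integral_const_mul]
    calc ‖f k q‖ * ∫ y, ‖φ y‖ * ‖f k y‖ ≤ ‖f k q‖ * (‖φ‖ * ‖f k‖) := by
          gcongr
          exact integral_norm_mul_norm_le φ (f k)
      _ = ‖φ‖ * (‖f k q‖ * ‖f k‖) := by ring
      _ ≤ ‖φ‖ * (‖f k q‖ ^ 2 + ‖f k‖ ^ 2) := by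
          gcongr
          nlinarith [sq_nonneg (‖f k q‖ - ‖f k‖), sq_nonneg ‖f k q‖, sq_nonneg ‖f k‖]
  have h' := hasSum_integral_of_summable_integral_norm hI' hs'
  calc ∑' k, (starRingEnd ℂ) (f k q) * ⟪φ, f k⟫_ℂ
      = ∑' k, ∫ y, (starRingEnd ℂ) (φ y) * ((starRingEnd ℂ) (f k q) * f k y) := by
        refine tsum_congr fun k => ?_
        rw [inner_eq_integral, ← integral_const_mul]
        exact integral_congr_ae (Filter.Eventually.of_forall fun y => by ring)
    _ = _ := by
        rw [h'.tsum_eq]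
        refine integral_congr_ae (Filter.Eventually.of_forall fun y => ?_)
        simp only [kernel]
        rw [tsum_mul_left]

/-- Distinct basis vectors are √2 apart, so balls of radius 1/2 around them are disjoint open sets.
Countability is needed for measurability of the kernel and for termwise integration. -/
lemma countable_of_hilbertBasis {H K : Type*} [NormedAddCommGroup H] [InnerProductSpace ℂ H]
    [SecondCountableTopology H] (b : HilbertBasis K ℂ H) : Countable K := by
  have hsep : ∀ i j, i ≠ j → (1 : ℝ) ≤ dist (b i) (b j) := by
    intro i j hij
    have h : ‖b i - b j‖ ^ 2 = 2 := by
      rw [@norm_sub_sq ℂ, b.orthonormal.2 hij, b.orthonormal.1, b.orthonormal.1]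
      norm_num
    rw [dist_eq_norm]
    nlinarith [norm_nonneg (b i - b j)]
  refine Pairwise.countable_of_isOpen_disjoint (s := fun i => Metric.ball (b i) (1 / 2)) ?_
    (fun _ => Metric.isOpen_ball) (fun i => ⟨b i, Metric.mem_ball_self (by norm_num)⟩)
  intro i j hij
  refine Metric.ball_disjoint_ball ?_
  linarith [hsep i j hij]

instance : SecondCountableTopology (ModeSpace ι) := by
  have : Fact ((2 : ENNReal) ≠ ⊤) := ⟨by simp⟩
  exact Lp.SecondCountableTopology

/-- Density operators with the same characteristic function are equal. -/
theorem eq_of_trace_mul_weyl_eq {ρ σ : ModeSpace ι →L[ℂ] ModeSpace ι} (hρ : IsDensityOperator ρ)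
    (hσ : IsDensityOperator σ) (h : ∀ ξ, trace (ρ * weyl ξ) = trace (σ * weyl ξ)) : ρ = σ := by
  have hc := countable_of_hilbertBasis (someBasis (ModeSpace ι))
  obtain ⟨f, hf, hfX, hfi⟩ := hρ.exists_tsum_rankOne (someBasis (ModeSpace ι))
  obtain ⟨g, hg, hgX, hgi⟩ := hσ.exists_tsum_rankOne (someBasis (ModeSpace ι))
  have hk := ae_kernel_eq hf hg fun ξ => by rw [← hfX, ← hgX, h]
  refine ContinuousLinearMap.ext fun ψ => ext_inner_left ℂ fun φ => ?_
  rw [hfi, hgi, tsum_inner_mul_inner_eq_integral_kernel hf,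
    tsum_inner_mul_inner_eq_integral_kernel hg]
  refine integral_congr_ae ?_
  filter_upwards [hk] with q hq
  congr 1
  refine integral_congr_ae ?_
  filter_upwards [hq] with y hy
  rw [hy]

end CharacteristicFunction

/-! ## Sums of products over function types -/

section SumsOfProducts

open scoped ENNReal

universe u

lemma ennreal_tsum_pi_prod {K : Type*} (D : Type u) [Fintype D] (f : D → K → ℝ≥0∞) :
    ∑' k : D → K, ∏ d, f d (k d) = ∏ d, ∑' i, f d i := by
  classical
  revert f
  refine Fintype.induction_empty_option
    (P := fun D _ => ∀ f : D → K → ℝ≥0∞, ∑' k : D → K, ∏ d, f d (k d) = ∏ d, ∑' i, f d i)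
    ?_ ?_ ?_ D
  · intro α β _ e ih f
    let _ : Fintype α := Fintype.ofEquiv β e.symm
    rw [← (Equiv.arrowCongr e (Equiv.refl K)).tsum_eq, ← e.prod_comp, ← ih fun a => f (e a)]
    refine tsum_congr fun k => ?_
    rw [← e.prod_comp]
    simp
  · intro f
    rw [tsum_eq_single default (fun b hb => (hb (Subsingleton.elim _ _)).elim)]
    simp
  · intro α _ ih f
    rw [← (Equiv.piOptionEquivProd (β := fun _ : Option α => K)).symm.tsum_eq, ENNReal.tsum_prod',
      Fintype.prod_option, ← ih fun a => f (some a), ← ENNReal.tsum_mul_right]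
    refine tsum_congr fun i => ?_
    rw [← ENNReal.tsum_mul_left]
    refine tsum_congr fun k => ?_
    rw [Fintype.prod_option]
    simp [Equiv.piOptionEquivProd]

lemma tsum_pi_prod_of_equiv {K : Type*} {α β : Type*} [Fintype α] [Fintype β] (e : α ≃ β)
    (f : β → K → ℂ)
    (ih : (Summable fun k : α → K => ‖∏ d, f (e d) (k d)‖) ∧
      ∑' k : α → K, ∏ d, f (e d) (k d) = ∏ d, ∑' i, f (e d) i) :
    (Summable fun k : β → K => ‖∏ d, f d (k d)‖) ∧
      ∑' k : β → K, ∏ d, f d (k d) = ∏ d, ∑' i, f d i := by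
  obtain ⟨ih1, ih2⟩ := ih
  have h : ∀ k : α → K, ∏ d, f d (Equiv.arrowCongr e (Equiv.refl K) k d) =
      ∏ a, f (e a) (k a) := by
    intro k
    rw [← e.prod_comp]
    simp
  refine ⟨?_, ?_⟩
  · rw [← (Equiv.arrowCongr e (Equiv.refl K)).summable_iff]
    exact ih1.congr fun k => by rw [Function.comp_apply, h]
  · rw [← (Equiv.arrowCongr e (Equiv.refl K)).tsum_eq, ← e.prod_comp, ← ih2]
    exact tsum_congr h

lemma tsum_pi_prod_option {K : Type*} {α : Type*} [Fintype α] (f : Option α → K → ℂ)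
    (hf : Summable fun i => ‖f none i‖)
    (ih : (Summable fun k : α → K => ‖∏ d, f (some d) (k d)‖) ∧
      ∑' k : α → K, ∏ d, f (some d) (k d) = ∏ d, ∑' i, f (some d) i) :
    (Summable fun k : Option α → K => ‖∏ d, f d (k d)‖) ∧
      ∑' k : Option α → K, ∏ d, f d (k d) = ∏ d, ∑' i, f d i := by
  obtain ⟨ih1, ih2⟩ := ih
  have h : ∀ p : K × (α → K), ∏ d, f d ((Equiv.piOptionEquivProd
      (β := fun _ : Option α => K)).symm p d) = f none p.1 * ∏ a, f (some a) (p.2 a) := by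
    intro p
    rw [Fintype.prod_option]
    simp [Equiv.piOptionEquivProd]
  refine ⟨?_, ?_⟩
  · rw [← (Equiv.piOptionEquivProd (β := fun _ : Option α => K)).symm.summable_iff]
    refine (hf.mul_norm ih1).congr fun p => ?_
    rw [Function.comp_apply, h]
  · rw [← (Equiv.piOptionEquivProd (β := fun _ : Option α => K)).symm.tsum_eq,
      Fintype.prod_option, ← ih2, tsum_mul_tsum_of_summable_norm hf ih1]
    exact tsum_congr h

lemma tsum_pi_prod_empty {K : Type*} (f : PEmpty.{u + 1} → K → ℂ) :
    (Summable fun k : PEmpty.{u + 1} → K => ‖∏ d, f d (k d)‖) ∧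
      ∑' k : PEmpty.{u + 1} → K, ∏ d, f d (k d) = ∏ d, ∑' i, f d i := by
  have h0 : ∀ b : PEmpty.{u + 1} → K, b = default := fun b => Subsingleton.elim _ _
  refine ⟨Summable.of_finite, ?_⟩
  rw [tsum_eq_single default (fun b hb => (hb (h0 b)).elim)]
  simp

/-- Absolute summability and the value of the sum are proved by one induction, since the Cauchy
product in the step from α to `Option α` uses both. -/
lemma tsum_pi_prod {K : Type*} (D : Type u) [Fintype D] (f : D → K → ℂ)
    (hf : ∀ d, Summable fun i => ‖f d i‖) :
    (Summable fun k : D → K => ‖∏ d, f d (k d)‖) ∧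
      ∑' k : D → K, ∏ d, f d (k d) = ∏ d, ∑' i, f d i := by
  let P : ∀ (D : Type u) [Fintype D], Prop := fun D _ => ∀ f : D → K → ℂ,
    (∀ d, Summable fun i => ‖f d i‖) → (Summable fun k : D → K => ‖∏ d, f d (k d)‖) ∧
      ∑' k : D → K, ∏ d, f d (k d) = ∏ d, ∑' i, f d i
  have h1 : ∀ (α β : Type u) [Fintype β] (e : α ≃ β),
      @P α (@Fintype.ofEquiv α β ‹_› e.symm) → @P β ‹_› := by
    intro α β _ e ih f hf
    let _ : Fintype α := Fintype.ofEquiv β e.symm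
    exact tsum_pi_prod_of_equiv e f (ih (fun a => f (e a)) fun a => hf (e a))
  have h2 : P PEmpty := fun f _ => tsum_pi_prod_empty f
  have h3 : ∀ (α : Type u) [Fintype α], P α → P (Option α) := fun α _ ih f hf =>
    tsum_pi_prod_option f (hf none) (ih (fun a => f (some a)) fun a => hf (some a))
  exact Fintype.induction_empty_option (P := P) h1 h2 h3 D f hf

end SumsOfProducts

/-! ## Hilbert space tensor powers -/

section Tensor

open ContinuousLinearMap
open scoped ENNReal

variable {D : Type*} [Fintype D]
  {H : Type*} [NormedAddCommGroup H] [InnerProductSpace ℂ H] [CompleteSpace H]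
  {G : Type*} [NormedAddCommGroup G] [InnerProductSpace ℂ G] [CompleteSpace G]

/-- `T` exhibits `G` as the Hilbert space tensor product of copies of `H` indexed by `D`. -/
structure IsHilbertTensor (T : ContinuousMultilinearMap ℂ (fun _ : D => H) G) : Prop where
  inner_apply : ∀ a b, ⟪T a, T b⟫_ℂ = ∏ d, ⟪a d, b d⟫_ℂ
  eq_zero : ∀ x, (∀ a, ⟪T a, x⟫_ℂ = 0) → x = 0

/-- Continuous multilinear maps that agree on Hilbert bases are equal. -/
lemma multilinear_ext_hilbertBasis {K : Type*} {F : Type*} [NormedAddCommGroup F]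
    [NormedSpace ℂ F] {M M' : ContinuousMultilinearMap ℂ (fun _ : D => H) F}
    (e : D → HilbertBasis K ℂ H)
    (h : ∀ k : D → K, M (fun d => e d (k d)) = M' fun d => e d (k d)) : M = M' := by
  classical
  -- Induction on the set S of slots that hold arbitrary vectors, the other slots holding basis
  -- vectors; one slot is freed at a time by density of the span.
  have key : ∀ S : Finset D, ∀ b : D → H, (∀ d ∉ S, ∃ k, b d = e d k) → M b = M' b := by
    intro S
    induction S using Finset.induction_on with
    | empty =>
      intro b hb
      choose k hk using fun d => hb d (Finset.notMem_empty d)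
      have : b = fun d => e d (k d) := funext hk
      rw [this, h]
    | insert d S hd ih =>
      intro b hb
      have h1 : M.toContinuousLinearMap b d = M'.toContinuousLinearMap b d := by
        refine ContinuousLinearMap.ext_on (s := Set.range (e d)) ?_ ?_
        · exact Submodule.dense_iff_topologicalClosure_eq_top.2 (e d).dense_span
        · rintro _ ⟨k, rfl⟩
          refine ih _ fun d' hd' => ?_
          by_cases hdd : d' = d
          · subst hdd
            exact ⟨k, by simp⟩
          · obtain ⟨k', hk'⟩ := hb d' (by simp [hdd, hd'])
            exact ⟨k', by simp [hdd, hk']⟩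
      have h2 := DFunLike.congr_fun h1 (b d)
      simpa using h2
  exact ContinuousMultilinearMap.ext fun b => key Finset.univ b fun d hd =>
    (hd (Finset.mem_univ d)).elim

variable {T : ContinuousMultilinearMap ℂ (fun _ : D => H) G}

namespace IsHilbertTensor

lemma ext_inner (hT : IsHilbertTensor T) {x y : G} (h : ∀ a, ⟪T a, x⟫_ℂ = ⟪T a, y⟫_ℂ) : x = y :=
  sub_eq_zero.1 (hT.eq_zero _ fun a => by rw [inner_sub_right, h, sub_self])

lemma orthonormal (hT : IsHilbertTensor T) {K : Type*} (e : D → HilbertBasis K ℂ H) :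
    Orthonormal ℂ fun k : D → K => T fun d => e d (k d) := by
  classical
  rw [orthonormal_iff_ite]
  intro k l
  rw [hT.inner_apply]
  have h : ∀ d, ⟪e d (k d), e d (l d)⟫_ℂ = if k d = l d then 1 else 0 := fun d =>
    orthonormal_iff_ite.1 (e d).orthonormal (k d) (l d)
  simp_rw [h]
  rw [Finset.prod_ite_zero]
  simp [funext_iff]

lemma orthogonal_eq_bot (hT : IsHilbertTensor T) {K : Type*} (e : D → HilbertBasis K ℂ H) :
    (Submodule.span ℂ (Set.range fun k : D → K => T fun d => e d (k d)))ᗮ = ⊥ := by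
  rw [Submodule.eq_bot_iff]
  intro x hx
  refine hT.eq_zero x fun a => ?_
  have h0 : ∀ k : D → K, ⟪x, T fun d => e d (k d)⟫_ℂ = 0 := fun k =>
    (Submodule.mem_orthogonal' _ _).1 hx _ (Submodule.subset_span ⟨k, rfl⟩)
  -- Pairing with x is again continuous and multilinear in the factors, so vanishing on products of
  -- basis vectors implies vanishing on all products.
  have h1 : (innerSL ℂ x).compContinuousMultilinearMap T = 0 :=
    multilinear_ext_hilbertBasis e fun k => by simpa using h0 k
  have h2 := DFunLike.congr_fun h1 a
  rw [← inner_conj_symm, map_eq_zero]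
  simpa using h2

/-- The product basis. -/
noncomputable def basis (hT : IsHilbertTensor T) {K : Type*} (e : D → HilbertBasis K ℂ H) :
    HilbertBasis (D → K) ℂ G :=
  HilbertBasis.mkOfOrthogonalEqBot (hT.orthonormal e) (hT.orthogonal_eq_bot e)

lemma basis_apply (hT : IsHilbertTensor T) {K : Type*} (e : D → HilbertBasis K ℂ H) (k : D → K) :
    hT.basis e k = T fun d => e d (k d) := by
  rw [basis, HilbertBasis.coe_mkOfOrthogonalEqBot]

end IsHilbertTensor

/-- `B` is the tensor product of the operators `A d`. -/
def IsTensorOp (T : ContinuousMultilinearMap ℂ (fun _ : D => H) G) (B : G →L[ℂ] G)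
    (A : D → H →L[ℂ] H) : Prop :=
  ∀ a, B (T a) = T fun d => A d (a d)

lemma IsTensorOp.mul {B B' : G →L[ℂ] G} {A A' : D → H →L[ℂ] H} (h : IsTensorOp T B A)
    (h' : IsTensorOp T B' A') : IsTensorOp T (B * B') fun d => A d * A' d := by
  intro a
  rw [mul_apply_eq_comp, h' a, h]
  rfl

namespace IsHilbertTensor

lemma clm_ext (hT : IsHilbertTensor T) {B B' : G →L[ℂ] G} (h : ∀ a, B (T a) = B' (T a)) :
    B = B' := by
  refine ContinuousLinearMap.ext fun x => ext_inner_left ℂ fun y => ?_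
  rw [← adjoint_inner_left, ← adjoint_inner_left]
  have h1 : adjoint B y = adjoint B' y := hT.ext_inner fun a => by
    rw [adjoint_inner_right, adjoint_inner_right, h]
  rw [h1]

lemma isTensorOp_unique (hT : IsHilbertTensor T) {B B' : G →L[ℂ] G} {A : D → H →L[ℂ] H}
    (h : IsTensorOp T B A) (h' : IsTensorOp T B' A) : B = B' :=
  hT.clm_ext fun a => by rw [h, h']

lemma isTensorOp_star (hT : IsHilbertTensor T) {B : G →L[ℂ] G} {A : D → H →L[ℂ] H}
    (h : IsTensorOp T B A) : IsTensorOp T (star B) fun d => star (A d) := by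
  intro b
  refine hT.ext_inner fun a => ?_
  rw [star_eq_adjoint, adjoint_inner_right, h a, hT.inner_apply, hT.inner_apply]
  refine Finset.prod_congr rfl fun d _ => ?_
  simp only [star_eq_adjoint]
  rw [adjoint_inner_right]

/-- Unitaries carry one product basis to another, so their tensor product is defined directly,
without a norm estimate on sums of product vectors. -/
lemma exists_isTensorOp_unitary (hT : IsHilbertTensor T) (U : D → H ≃ₗᵢ[ℂ] H) :
    ∃ B : G →L[ℂ] G, ∀ a, B (T a) = T fun d => U d (a d) := by
  classical
  let e : D → HilbertBasis _ ℂ H := fun _ => someBasis H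
  let e' : D → HilbertBasis _ ℂ H := fun d => ⟨(U d).symm.trans (someBasis H).repr⟩
  have he' : ∀ d k, e' d k = U d (e d k) := by
    intro d k
    rw [← HilbertBasis.repr_symm_single, ← HilbertBasis.repr_symm_single]
    rfl
  let W : G ≃ₗᵢ[ℂ] G := (hT.basis e).repr.trans (hT.basis e').repr.symm
  have hW : ∀ k, W (hT.basis e k) = hT.basis e' k := by
    intro k
    simp only [W, LinearIsometryEquiv.trans_apply]
    rw [HilbertBasis.repr_self, HilbertBasis.repr_symm_single]
  refine ⟨(W : G ≃L[ℂ] G), fun a => ?_⟩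
  have h := multilinear_ext_hilbertBasis
    (M := ((W : G ≃L[ℂ] G) : G →L[ℂ] G).compContinuousMultilinearMap T)
    (M' := T.compContinuousLinearMap fun d => ((U d : H ≃L[ℂ] H) : H →L[ℂ] H)) e fun k => by
      have := hW k
      rw [hT.basis_apply, hT.basis_apply] at this
      simp_rw [he'] at this
      exact this
  exact DFunLike.congr_fun h a

/-- Every bounded operator is a linear combination of unitaries, and the slot-d extension is linear
in the operator; this reduces to the unitary case. -/
lemma exists_isTensorOp_single [DecidableEq D] (hT : IsHilbertTensor T) (d : D) (A : H →L[ℂ] H) :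
    ∃ B : G →L[ℂ] G, ∀ a, B (T a) = T (Function.update a d (A (a d))) := by
  have hA : A ∈ Submodule.span ℂ (unitary (H →L[ℂ] H) : Set (H →L[ℂ] H)) := by
    rw [CStarAlgebra.span_unitary]
    exact Submodule.mem_top
  induction hA using Submodule.span_induction with
  | mem u hu =>
    obtain ⟨B, hB⟩ := hT.exists_isTensorOp_unitary fun d' =>
      if d' = d then Unitary.linearIsometryEquiv ⟨u, hu⟩ else LinearIsometryEquiv.refl ℂ H
    refine ⟨B, fun a => ?_⟩
    rw [hB]
    congr 1
    funext d'
    by_cases hd : d' = d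
    · subst hd
      simp only [if_true, Function.update_self]
      rfl
    · simp [hd]
  | zero => exact ⟨0, fun a => (T.map_coord_zero d (by simp)).symm⟩
  | add x y _ _ hx hy =>
    obtain ⟨B, hB⟩ := hx
    obtain ⟨C, hC⟩ := hy
    exact ⟨B + C, fun a => by rw [add_apply, hB, hC, add_apply, T.map_update_add]⟩
  | smul c x _ hx =>
    obtain ⟨B, hB⟩ := hx
    exact ⟨c • B, fun a => by rw [smul_apply, hB, smul_apply, T.map_update_smul]⟩

/-- Tensor products of bounded operators exist. -/
lemma exists_isTensorOp (hT : IsHilbertTensor T) (A : D → H →L[ℂ] H) :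
    ∃ B : G →L[ℂ] G, IsTensorOp T B A := by
  classical
  have key : ∀ S : Finset D, ∃ B : G →L[ℂ] G, ∀ a,
      B (T a) = T fun d => if d ∈ S then A d (a d) else a d := by
    intro S
    induction S using Finset.induction_on with
    | empty => exact ⟨1, fun a => by simp⟩
    | insert d S hd ih =>
      obtain ⟨B, hB⟩ := ih
      obtain ⟨C, hC⟩ := hT.exists_isTensorOp_single d (A d)
      refine ⟨C * B, fun a => ?_⟩
      rw [mul_apply_eq_comp, hB, hC]
      congr 1
      funext d'
      by_cases h : d' = d
      · subst h
        simp [hd]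
      · simp [h]
  obtain ⟨B, hB⟩ := key Finset.univ
  exact ⟨B, fun a => by simpa using hB a⟩

/-- The tensor product of the square roots squares to B and is positive, so it is √B by uniqueness
of positive square roots. -/
lemma isTensorOp_sqrt (hT : IsHilbertTensor T) {B : G →L[ℂ] G} {A : D → H →L[ℂ] H}
    (hA : ∀ d, 0 ≤ A d) (h : IsTensorOp T B A) :
    0 ≤ B ∧ IsTensorOp T (CFC.sqrt B) fun d => CFC.sqrt (A d) := by
  have hpos : ∀ {B : G →L[ℂ] G} {A : D → H →L[ℂ] H}, (∀ d, 0 ≤ A d) → IsTensorOp T B A → 0 ≤ B := by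
    intro B A hA h
    obtain ⟨S, hS⟩ := hT.exists_isTensorOp fun d => CFC.sqrt (A d)
    have h1 := (hT.isTensorOp_star hS).mul hS
    simp_rw [star_sqrt_mul_sqrt (hA _)] at h1
    rw [hT.isTensorOp_unique h h1]
    exact star_mul_self_nonneg S
  obtain ⟨S, hS⟩ := hT.exists_isTensorOp fun d => CFC.sqrt (A d)
  -- Positivity of S is obtained from the square roots of the operators √(A d).
  have hS0 : 0 ≤ S := hpos (fun d => CFC.sqrt_nonneg (A d)) hS
  have h1 := hS.mul hS
  have h2 : ∀ d, CFC.sqrt (A d) * CFC.sqrt (A d) = A d := fun d =>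
    CFC.sqrt_mul_sqrt_self (A d) (hA d)
  simp_rw [h2] at h1
  rw [CFC.sqrt_unique (hT.isTensorOp_unique h1 h) hS0]
  exact ⟨hpos hA h, hS⟩

lemma etrace_eq_prod (hT : IsHilbertTensor T) {B : G →L[ℂ] G} {A : D → H →L[ℂ] H}
    (hA : ∀ d, 0 ≤ A d) (h : IsTensorOp T B A) : etrace B = ∏ d, etrace (A d) := by
  rw [etrace_eq (hT.basis fun _ => someBasis H) (hT.isTensorOp_sqrt hA h).1]
  unfold etrace
  rw [← ennreal_tsum_pi_prod]
  refine tsum_congr fun k => ?_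
  rw [hT.basis_apply, h, hT.inner_apply]
  have h1 : ∀ d, ⟪someBasis H (k d), A d (someBasis H (k d))⟫_ℂ =
      ((⟪someBasis H (k d), A d (someBasis H (k d))⟫_ℂ).re : ℂ) := fun d =>
    inner_eq_ofReal_re (hA d) _
  rw [Finset.prod_congr rfl fun d _ => h1 d, ← Complex.ofReal_prod, Complex.ofReal_re,
    ENNReal.ofReal_prod_of_nonneg fun d _ => re_inner_nonneg (hA d) _]

lemma isDensityOperator (hT : IsHilbertTensor T) {B : G →L[ℂ] G} {A : D → H →L[ℂ] H}
    (hA : ∀ d, IsDensityOperator (A d)) (h : IsTensorOp T B A) : IsDensityOperator B := by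
  have hA0 := fun d => (isDensityOperator_iff.1 (hA d)).1
  refine isDensityOperator_iff.2 ⟨(hT.isTensorOp_sqrt hA0 h).1, ?_⟩
  rw [hT.etrace_eq_prod hA0 h]
  exact Finset.prod_eq_one fun d _ => (isDensityOperator_iff.1 (hA d)).2

/-- The fidelity is multiplicative under tensor products. -/
theorem fidelity_eq_prod (hT : IsHilbertTensor T) {R R' : G →L[ℂ] G} {ρ ρ' : D → H →L[ℂ] H}
    (hρ : ∀ d, 0 ≤ ρ d) (hρ' : ∀ d, 0 ≤ ρ' d) (h : IsTensorOp T R ρ) (h' : IsTensorOp T R' ρ') :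
    fidelity R R' = ∏ d, fidelity (ρ d) (ρ' d) := by
  have hs := (hT.isTensorOp_sqrt hρ h).2
  have hpos : ∀ d, 0 ≤ CFC.sqrt (ρ d) * ρ' d * CFC.sqrt (ρ d) := by
    intro d
    have := star_left_conjugate_nonneg (hρ' d) (CFC.sqrt (ρ d))
    rwa [star_sqrt] at this
  have h1 := (hT.isTensorOp_sqrt hpos ((hs.mul h').mul hs)).2
  have hpos' : ∀ d, 0 ≤ CFC.sqrt (CFC.sqrt (ρ d) * ρ' d * CFC.sqrt (ρ d)) := fun d =>
    CFC.sqrt_nonneg (CFC.sqrt (ρ d) * ρ' d * CFC.sqrt (ρ d))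
  rw [fidelity_eq, hT.etrace_eq_prod hpos' h1, ENNReal.toReal_prod]
  exact Finset.prod_congr rfl fun d _ => (fidelity_eq _ _).symm

/-- In the product basis the diagonal entries factor. The bound |⟨x, Yx⟩| ≤ ‖Y‖‖x‖² at x = √ρ e_j
gives the absolute summability that splits the sum. -/
lemma trace_mul_eq_prod (hT : IsHilbertTensor T) {R X : G →L[ℂ] G} {ρ Y : D → H →L[ℂ] H}
    (hρ : ∀ d, IsDensityOperator (ρ d)) (h : IsTensorOp T R ρ) (hX : IsTensorOp T X Y) :
    trace (R * X) = ∏ d, trace (ρ d * Y d) := by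
  have hs := (hT.isTensorOp_sqrt (fun d => (isDensityOperator_iff.1 (hρ d)).1) h).2
  rw [trace_mul_eq_tsum (hT.basis fun _ => someBasis H) (hT.isDensityOperator hρ h)]
  simp_rw [trace_mul_eq_tsum (someBasis H) (hρ _)]
  rw [← (tsum_pi_prod D (fun d j => ⟪CFC.sqrt (ρ d) (someBasis H j),
    Y d (CFC.sqrt (ρ d) (someBasis H j))⟫_ℂ) fun d => ?_).2]
  · refine tsum_congr fun k => ?_
    rw [hT.basis_apply, hs, hX, hT.inner_apply]
  · refine Summable.of_nonneg_of_le (fun _ => norm_nonneg _) (fun j => ?_)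
      ((summable_norm_sqrt_sq (someBasis H) (hρ d)).mul_left ‖Y d‖)
    refine (norm_inner_le_norm _ _).trans ?_
    have := (Y d).le_opNorm (CFC.sqrt (ρ d) (someBasis H j))
    nlinarith [norm_nonneg (CFC.sqrt (ρ d) (someBasis H j))]

end IsHilbertTensor

end Tensor

/-! ## Product wave functions -/

section ProductWaveFunctions

open scoped ENNReal

variable {D κ : Type*} [Fintype D] [Fintype κ]

lemma measurePreserving_curry :
    MeasurePreserving (MeasurableEquiv.curry D κ ℝ) volume volume := by
  have h : MeasurePreserving (MeasurableEquiv.curry D κ ℝ).symm volume volume := by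
    refine ⟨(MeasurableEquiv.curry D κ ℝ).symm.measurable, ?_⟩
    refine (Measure.pi_eq fun s hs => ?_).symm
    rw [MeasurableEquiv.map_apply]
    have h1 : (MeasurableEquiv.curry D κ ℝ).symm ⁻¹' (Set.univ.pi s) =
        Set.univ.pi fun d => Set.univ.pi fun k => s (d, k) := by
      ext q
      simp only [Set.mem_preimage, Set.mem_univ_pi, Prod.forall]
      rfl
    rw [h1, volume_pi_pi]
    simp_rw [volume_pi_pi]
    rw [Fintype.prod_prod_type]
  exact h.symm

lemma integral_prod_blocks (g : D → (κ → ℝ) → ℂ) :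
    ∫ q : D × κ → ℝ, ∏ d, g d (fun k => q (d, k)) = ∏ d, ∫ y, g d y := by
  have h := (measurePreserving_curry (D := D) (κ := κ)).integral_comp'
    fun y : D → κ → ℝ => ∏ d, g d (y d)
  rw [← integral_fintype_prod_volume_eq_prod, ← h]
  rfl

lemma integrable_prod_blocks {g : D → (κ → ℝ) → ℂ} (hg : ∀ d, Integrable (g d)) :
    Integrable fun q : D × κ → ℝ => ∏ d, g d (fun k => q (d, k)) :=
  (measurePreserving_curry (D := D) (κ := κ)).integrable_comp_of_integrable
    (Integrable.fintype_prod hg)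

lemma ae_eq_prod_blocks {f g : D → (κ → ℝ) → ℂ} (h : ∀ d, f d =ᵐ[volume] g d) :
    (fun q : D × κ → ℝ => ∏ d, f d (fun k => q (d, k))) =ᵐ[volume]
      fun q => ∏ d, g d (fun k => q (d, k)) := by
  have h1 := Measure.ae_eq_pi (μ := fun _ : D => (volume : Measure (κ → ℝ))) h
  have h2 := (measurePreserving_curry (D := D) (κ := κ)).quasiMeasurePreserving.ae_eq_comp h1
  filter_upwards [h2] with q hq
  exact Finset.prod_congr rfl fun d _ => congrFun hq d

lemma memLp_prod_blocks (f : D → ModeSpace κ) :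
    MemLp (fun q : D × κ → ℝ => ∏ d, f d (fun k => q (d, k))) 2 := by
  have hm : Measurable fun q : D × κ → ℝ => ∏ d, f d (fun k => q (d, k)) := by
    refine Finset.measurable_fun_prod _ fun d _ => ?_
    exact (Lp.stronglyMeasurable (f d)).measurable.comp (by fun_prop)
  rw [memLp_two_iff_integrable_sq_norm hm.aestronglyMeasurable]
  have h := integrable_prod_blocks fun d => (integrable_norm_sq (f d)).ofReal (𝕜 := ℂ)
  refine h.norm.congr (Filter.Eventually.of_forall fun q => ?_)
  simp only [norm_prod, ← Finset.prod_pow]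
  refine Finset.prod_congr rfl fun d _ => ?_
  simp

/-- The product wave function `q ↦ ∏ d, f d (q (d, ·))`. -/
noncomputable def prodWave (f : D → ModeSpace κ) : ModeSpace (D × κ) :=
  (memLp_prod_blocks f).toLp _

lemma prodWave_ae (f : D → ModeSpace κ) :
    (prodWave f : (D × κ → ℝ) → ℂ) =ᵐ[volume] fun q => ∏ d, f d (fun k => q (d, k)) :=
  (memLp_prod_blocks f).coeFn_toLp

lemma prodWave_ae_of_ae_eq {f : D → ModeSpace κ} {g : D → (κ → ℝ) → ℂ}
    (h : ∀ d, f d =ᵐ[volume] g d) :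
    (prodWave f : (D × κ → ℝ) → ℂ) =ᵐ[volume] fun q => ∏ d, g d (fun k => q (d, k)) :=
  (prodWave_ae f).trans (ae_eq_prod_blocks h)

lemma inner_prodWave (f g : D → ModeSpace κ) :
    ⟪prodWave f, prodWave g⟫_ℂ = ∏ d, ⟪f d, g d⟫_ℂ := by
  simp_rw [inner_eq_integral]
  rw [← integral_prod_blocks]
  refine integral_congr_ae ?_
  filter_upwards [prodWave_ae f, prodWave_ae g] with q hf hg
  rw [hf, hg, map_prod, ← Finset.prod_mul_distrib]

lemma norm_prodWave (f : D → ModeSpace κ) : ‖prodWave f‖ = ∏ d, ‖f d‖ := by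
  have h := inner_prodWave f f
  simp_rw [inner_self_eq_norm_sq_to_K] at h
  have h2 : ‖prodWave f‖ ^ 2 = (∏ d, ‖f d‖) ^ 2 := by
    rw [← Finset.prod_pow]
    have h3 := congrArg (fun z : ℂ => ‖z‖) h
    simpa [norm_prod] using h3
  exact (pow_left_inj₀ (norm_nonneg _) (Finset.prod_nonneg fun _ _ => norm_nonneg _)
    two_ne_zero).1 h2

/-- The product wave function, as a continuous multilinear map. -/
noncomputable def prodWaveL (D κ : Type*) [Fintype D] [Fintype κ] :
    ContinuousMultilinearMap ℂ (fun _ : D => ModeSpace κ) (ModeSpace (D × κ)) :=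
  MultilinearMap.mkContinuous
    { toFun := prodWave
      map_update_add' := by
        intro _ f d x y
        ext1
        refine (prodWave_ae _).trans ?_
        -- Additivity in L² holds only almost everywhere in the coordinates of block d; it is pulled
        -- back along the projection to that block, which is quasi-measure-preserving.
        have hadd := (measurePreserving_curry (D := D) (κ := κ)).quasiMeasurePreserving.ae
          ((Measure.quasiMeasurePreserving_eval
            (fun _ : D => (volume : Measure (κ → ℝ))) d).ae (Lp.coeFn_add x y))
        filter_upwards [hadd, Lp.coeFn_add (prodWave (Function.update f d x))
          (prodWave (Function.update f d y)), prodWave_ae (Function.update f d x),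
          prodWave_ae (Function.update f d y)] with q hq h1 h2 h3
        have hq' : (x + y : ModeSpace κ) (fun k => q (d, k)) =
          x (fun k => q (d, k)) + y (fun k => q (d, k)) := hq
        rw [h1, Pi.add_apply, h2, h3]
        have hp : ∀ z : ModeSpace κ, ∏ d', (Function.update f d z d') (fun k => q (d', k)) =
            z (fun k => q (d, k)) * ∏ d' ∈ Finset.univ.erase d, f d' (fun k => q (d', k)) := by
          intro z
          rw [← Finset.mul_prod_erase _ _ (Finset.mem_univ d), Function.update_self]
          congr 1
          refine Finset.prod_congr rfl fun d' hd' => ?_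
          rw [Function.update_of_ne (Finset.ne_of_mem_erase hd')]
        rw [hp, hp, hp, hq', add_mul]
      map_update_smul' := by
        intro _ f d c x
        ext1
        refine (prodWave_ae _).trans ?_
        have hsmul := (measurePreserving_curry (D := D) (κ := κ)).quasiMeasurePreserving.ae
          ((Measure.quasiMeasurePreserving_eval
            (fun _ : D => (volume : Measure (κ → ℝ))) d).ae (Lp.coeFn_smul c x))
        filter_upwards [hsmul, Lp.coeFn_smul c (prodWave (Function.update f d x)),
          prodWave_ae (Function.update f d x)] with q hq h1 h2
        have hq' : (c • x : ModeSpace κ) (fun k => q (d, k)) = c * x (fun k => q (d, k)) := hq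
        rw [h1, Pi.smul_apply, h2, smul_eq_mul]
        have hp : ∀ z : ModeSpace κ, ∏ d', (Function.update f d z d') (fun k => q (d', k)) =
            z (fun k => q (d, k)) * ∏ d' ∈ Finset.univ.erase d, f d' (fun k => q (d', k)) := by
          intro z
          rw [← Finset.mul_prod_erase _ _ (Finset.mem_univ d), Function.update_self]
          congr 1
          refine Finset.prod_congr rfl fun d' hd' => ?_
          rw [Function.update_of_ne (Finset.ne_of_mem_erase hd')]
        rw [hp, hp, hq', mul_assoc] }
    1 fun f => by
      rw [one_mul]
      exact (norm_prodWave f).le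

lemma prodWaveL_apply (f : D → ModeSpace κ) : prodWaveL D κ f = prodWave f := rfl

/-! ### Gaussian wave functions -/

lemma integrable_gaussian : Integrable fun y : κ → ℝ => ((∏ j, Real.exp (-y j ^ 2) : ℝ) : ℂ) := by
  have h := Integrable.fintype_prod (μ := fun _ : κ => (volume : Measure ℝ))
    (f := fun _ y => ((Real.exp (-y ^ 2) : ℝ) : ℂ)) fun _ =>
      (by simpa using integrable_exp_neg_mul_sq one_pos : Integrable fun y : ℝ =>
        Real.exp (-y ^ 2)).ofReal
  refine h.congr (Filter.Eventually.of_forall fun y => ?_)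
  push_cast
  rfl

lemma memLp_gaussian_phase (s : κ → ℝ) :
    MemLp (fun y : κ → ℝ => Complex.exp (((∑ j, s j * y j : ℝ) : ℂ) * Complex.I) *
      ((∏ j, Real.exp (-y j ^ 2 / 2) : ℝ) : ℂ)) 2 := by
  have hc : Continuous fun y : κ → ℝ => Complex.exp (((∑ j, s j * y j : ℝ) : ℂ) * Complex.I) *
      ((∏ j, Real.exp (-y j ^ 2 / 2) : ℝ) : ℂ) := by fun_prop
  rw [memLp_two_iff_integrable_sq_norm hc.aestronglyMeasurable]
  refine integrable_gaussian.norm.congr (Filter.Eventually.of_forall fun y => ?_)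
  simp only [norm_mul, Complex.norm_exp_ofReal_mul_I, one_mul, Complex.norm_real, norm_prod,
    ← Finset.prod_pow]
  refine Finset.prod_congr rfl fun j _ => ?_
  rw [Real.norm_eq_abs, Real.norm_eq_abs, Real.abs_exp, Real.abs_exp, ← Real.exp_nat_mul]
  congr 1
  push_cast
  ring

/-- Modulated Gaussians are product functions. Orthogonality of x to all of them says that the
Fourier transform of γx vanishes, where the Gaussian γ makes γx integrable and has no zeros. -/
lemma prodWaveL_eq_zero {x : ModeSpace (D × κ)} (h : ∀ f, ⟪prodWaveL D κ f, x⟫_ℂ = 0) :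
    x = 0 := by
  set γ : (D × κ → ℝ) → ℂ := fun q => ((∏ j, Real.exp (-q j ^ 2 / 2) : ℝ) : ℂ) with hγ
  set w : (D × κ → ℝ) → D → ModeSpace κ := fun s d =>
    -- The sign of s offsets the conjugation in the first argument of the inner product.
    (memLp_gaussian_phase fun k => -s (d, k)).toLp _ with hw
  have hwae : ∀ s, (prodWave (w s) : (D × κ → ℝ) → ℂ) =ᵐ[volume] fun q =>
      Complex.exp (-((∑ j, s j * q j : ℝ) : ℂ) * Complex.I) * γ q := by
    intro s
    refine (prodWave_ae_of_ae_eq fun d => (memLp_gaussian_phase _).coeFn_toLp).trans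
      (Filter.Eventually.of_forall fun q => ?_)
    simp only [hγ]
    rw [Finset.prod_mul_distrib, ← Complex.exp_sum, ← Complex.ofReal_prod, Fintype.prod_prod_type,
      Fintype.sum_prod_type, ← Finset.sum_mul]
    congr 3
    push_cast
    simp
  have hcongr : ∀ s, (fun q => (starRingEnd ℂ) (prodWave (w s) q) * x q) =ᵐ[volume] fun q =>
      Complex.exp (((∑ j, s j * q j : ℝ) : ℂ) * Complex.I) * (γ q * x q) := by
    intro s
    filter_upwards [hwae s] with q hq
    rw [hq, map_mul, ← Complex.exp_conj, ← mul_assoc]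
    congr 2
    · congr 1
      rw [map_mul, map_neg, Complex.conj_ofReal, Complex.conj_I]
      ring
    · exact Complex.conj_ofReal _
  have hI : Integrable fun q => γ q * x q := by
    refine ((integrable_conj_mul (prodWave (w 0)) x).congr (hcongr 0)).congr
      (Filter.Eventually.of_forall fun q => ?_)
    simp
  have h0 := ae_eq_zero_of_fourier_eq_zero hI fun s => by
    rw [← integral_congr_ae (hcongr s), ← inner_eq_integral]
    exact h (w s)
  rw [Lp.eq_zero_iff_ae_eq_zero]
  filter_upwards [h0] with q hq
  have hne : γ q ≠ 0 := by
    simp only [hγ, ne_eq, Complex.ofReal_eq_zero]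
    exact (Finset.prod_pos fun j _ => Real.exp_pos _).ne'
  exact (mul_eq_zero.1 hq).resolve_left hne

lemma isHilbertTensor_prodWaveL : IsHilbertTensor (prodWaveL D κ) :=
  ⟨inner_prodWave, fun _ => prodWaveL_eq_zero⟩

/-- Weyl operators are tensor products of Weyl operators. -/
lemma isTensorOp_weyl (ξ : (D × κ) × Fin 2 → ℝ) :
    IsTensorOp (prodWaveL D κ) (weyl ξ) fun d => weyl fun p => ξ ((d, p.1), p.2) := by
  intro f
  rw [prodWaveL_apply, prodWaveL_apply]
  ext1
  refine (weyl_apply_ae ξ (prodWave f)).trans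
    (Filter.EventuallyEq.trans ?_ (prodWave_ae_of_ae_eq fun d => weyl_apply_ae _ (f d)).symm)
  have h := (measurePreserving_add_right (volume : Measure (D × κ → ℝ))
    (fun j => ξ (j, 1))).quasiMeasurePreserving.ae (prodWave_ae f)
  filter_upwards [h] with q hq
  rw [hq, Finset.prod_mul_distrib]
  congr 1
  simp only [weylPhase]
  rw [← Complex.exp_sum, ← Finset.sum_mul]
  congr 2
  rw [← Complex.ofReal_sum, Finset.sum_add_distrib, ← Finset.sum_div, Fintype.sum_prod_type,
    Fintype.sum_prod_type]

/-- A Gaussian state whose covariance matrix is a direct sum is a tensor product. -/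
theorem IsGaussianState.isTensorOp {V : Matrix ((D × κ) × Fin 2) ((D × κ) × Fin 2) ℝ}
    {v : D → Matrix (κ × Fin 2) (κ × Fin 2) ℝ}
    (hV : ∀ ξ : (D × κ) × Fin 2 → ℝ, ξ ⬝ᵥ V.mulVec ξ =
      ∑ d, (fun p : κ × Fin 2 => ξ ((d, p.1), p.2)) ⬝ᵥ
        (v d).mulVec fun p => ξ ((d, p.1), p.2))
    {ρ : ModeSpace (D × κ) →L[ℂ] ModeSpace (D × κ)} {σ : D → ModeSpace κ →L[ℂ] ModeSpace κ}
    (hρ : IsGaussianState V ρ) (hσ : ∀ d, IsGaussianState (v d) (σ d)) :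
    IsTensorOp (prodWaveL D κ) ρ σ := by
  have hT := isHilbertTensor_prodWaveL (D := D) (κ := κ)
  obtain ⟨R, hR⟩ := hT.exists_isTensorOp σ
  have hσd := fun d => (hσ d).isDensityOperator
  have h : ρ = R := by
    refine eq_of_trace_mul_weyl_eq hρ.isDensityOperator (hT.isDensityOperator hσd hR) fun ξ => ?_
    rw [hρ.charFun_eq, hT.trace_mul_eq_prod hσd hR (isTensorOp_weyl ξ)]
    simp_rw [(hσ _).charFun_eq]
    rw [← Complex.ofReal_prod, ← Real.exp_sum, ← Finset.mul_sum, hV]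
  rw [h]
  exact hR

end ProductWaveFunctions

/-! ## Permutations of modes -/

section Permutations

open ContinuousLinearMap

variable {ι : Type*} [Fintype ι]

lemma measurePreserving_comp_perm (e : Equiv.Perm ι) :
    MeasurePreserving (fun q : ι → ℝ => q ∘ e) volume volume := by
  have h := volume_measurePreserving_piCongrLeft (fun _ : ι => ℝ) e.symm
  convert h using 1
  funext q
  funext j
  obtain ⟨i, rfl⟩ := e.symm.surjective j
  rw [MeasurableEquiv.coe_piCongrLeft, Equiv.piCongrLeft_apply_apply]
  simp

/-- The unitary operator `ψ ↦ ψ(· ∘ e)` that permutes the modes. -/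
noncomputable def permOp (e : Equiv.Perm ι) : ModeSpace ι →L[ℂ] ModeSpace ι :=
  (Lp.compMeasurePreservingₗᵢ ℂ (fun q : ι → ℝ => q ∘ e)
    (measurePreserving_comp_perm e)).toContinuousLinearMap

lemma permOp_ae (e : Equiv.Perm ι) (ψ : ModeSpace ι) :
    (permOp e ψ : (ι → ℝ) → ℂ) =ᵐ[volume] fun q => ψ (q ∘ e) :=
  Lp.coeFn_compMeasurePreserving ψ (measurePreserving_comp_perm e)

lemma star_permOp_mul_permOp (e : Equiv.Perm ι) : star (permOp e) * permOp e = 1 :=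
  (norm_map_iff_adjoint_comp_self (permOp e)).1 fun ψ =>
    (Lp.compMeasurePreservingₗᵢ ℂ (fun q : ι → ℝ => q ∘ e)
      (measurePreserving_comp_perm e)).norm_map ψ

lemma weyl_mul_permOp (e : Equiv.Perm ι) (ξ : ι × Fin 2 → ℝ) :
    weyl ξ * permOp e = permOp e * weyl fun p => ξ (e p.1, p.2) := by
  refine ContinuousLinearMap.ext fun ψ => ?_
  rw [mul_apply_eq_comp, mul_apply_eq_comp]
  ext1
  refine (weyl_apply_ae ξ (permOp e ψ)).trans
    (Filter.EventuallyEq.trans ?_ (permOp_ae e _).symm)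
  have h1 := (measurePreserving_add_right (volume : Measure (ι → ℝ))
    (fun j => ξ (j, 1))).quasiMeasurePreserving.ae (permOp_ae e ψ)
  have h2 := (measurePreserving_comp_perm e).quasiMeasurePreserving.ae
    (weyl_apply_ae (fun p => ξ (e p.1, p.2)) ψ)
  filter_upwards [h1, h2] with q hq1 hq2
  rw [hq1, hq2]
  congr 1
  simp only [weylPhase, Function.comp_apply]
  rw [Equiv.sum_comp e fun j => ξ (j, 0) * q j, Equiv.sum_comp e fun j => ξ (j, 0) * ξ (j, 1)]

lemma IsGaussianState.permOp_conj {V : Matrix (ι × Fin 2) (ι × Fin 2) ℝ}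
    {ρ : ModeSpace ι →L[ℂ] ModeSpace ι} (hρ : IsGaussianState V ρ) (e : Equiv.Perm ι) :
    IsGaussianState (V.submatrix (Prod.map e.symm id) (Prod.map e.symm id))
      (permOp e * ρ * star (permOp e)) := by
  refine ⟨isDensityOperator_unitary_conj (star_permOp_mul_permOp e) hρ.isDensityOperator,
    fun ξ => ?_⟩
  rw [trace_unitary_conj_mul _ hρ.isDensityOperator, mul_assoc (star _), weyl_mul_permOp,
    ← mul_assoc (star _), star_permOp_mul_permOp, one_mul, hρ.charFun_eq]
  let e' : (ι × Fin 2) ≃ (ι × Fin 2) := Equiv.prodCongr e (Equiv.refl _)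
  have hq : (fun p : ι × Fin 2 => ξ (e p.1, p.2)) ⬝ᵥ
      V.mulVec (fun p : ι × Fin 2 => ξ (e p.1, p.2)) =
      ξ ⬝ᵥ (V.submatrix (Prod.map e.symm id) (Prod.map e.symm id)).mulVec ξ := by
    simp only [dotProduct, Matrix.mulVec, Matrix.submatrix_apply]
    rw [← Equiv.sum_comp e' fun x => ξ x * _]
    refine Finset.sum_congr rfl fun x _ => ?_
    rw [← Equiv.sum_comp e' fun y => _ * ξ y]
    simp [e', Prod.map]
  rw [hq]

lemma IsGaussianState.unique {V : Matrix (ι × Fin 2) (ι × Fin 2) ℝ}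
    {ρ σ : ModeSpace ι →L[ℂ] ModeSpace ι} (hρ : IsGaussianState V ρ) (hσ : IsGaussianState V σ) :
    ρ = σ :=
  eq_of_trace_mul_weyl_eq hρ.isDensityOperator hσ.isDensityOperator fun ξ => by
    rw [hρ.charFun_eq, hσ.charFun_eq]

end Permutations

/-! ## Covariance matrices of the outputs -/

section Outputs

lemma channelCM_apply {ι : Type*} [Fintype ι] [DecidableEq ι] (E : ι → GPIChannel)
    (V : Matrix (ι × Fin 2) (ι × Fin 2) ℝ) (x y : ι × Fin 2) :
    channelCM E V x y = √(E x.1).τ * V x y * √(E y.1).τ + if x = y then (E x.1).ν else 0 := by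
  rw [channelCM, Matrix.diagonal_transpose, Matrix.add_apply, Matrix.mul_diagonal,
    Matrix.diagonal_mul, Matrix.diagonal_apply]

/-- The TMSV covariance matrix is symmetric under exchange of its modes, so exchanging the output
modes amounts to exchanging the channels; uniqueness of Gaussian states concludes. -/
lemma twoMode_swap {E : Bool → GPIChannel} {N : ℝ}
    {σ : (Fin 2 → Bool) → (ModeSpace (Fin 2) →L[ℂ] ModeSpace (Fin 2))}
    (hσ : ∀ a, IsTwoModeOutput E N a (σ a)) (x y : Bool) :
    σ ![y, x] = permOp (Equiv.swap 0 1) * σ ![x, y] * star (permOp (Equiv.swap 0 1)) := by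
  refine (hσ ![y, x]).unique ?_
  have h := (hσ ![x, y]).permOp_conj (Equiv.swap 0 1)
  convert h using 1
  ext p q
  rw [Matrix.submatrix_apply, channelCM_apply, channelCM_apply]
  obtain ⟨p, a⟩ := p
  obtain ⟨q, b⟩ := q
  fin_cases p <;> fin_cases q <;> simp [tmsvCM]

lemma fidelity_twoMode_swap {E : Bool → GPIChannel} {N : ℝ}
    {σ : (Fin 2 → Bool) → (ModeSpace (Fin 2) →L[ℂ] ModeSpace (Fin 2))}
    (hσ : ∀ a, IsTwoModeOutput E N a (σ a)) (x y x' y' : Bool) :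
    fidelity (σ ![y, x]) (σ ![y', x']) = fidelity (σ ![x, y]) (σ ![x', y']) := by
  have h0 := fun a => (isDensityOperator_iff.1 (hσ a).isDensityOperator).1
  rw [twoMode_swap hσ x y, twoMode_swap hσ x' y',
    fidelity_unitary_conj (star_permOp_mul_permOp _) (h0 _) (h0 _)]

lemma fidelity_twoMode_comm {E : Bool → GPIChannel} {N : ℝ}
    {σ : (Fin 2 → Bool) → (ModeSpace (Fin 2) →L[ℂ] ModeSpace (Fin 2))}
    (hσ : ∀ a, IsTwoModeOutput E N a (σ a)) (a b : Fin 2 → Bool) :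
    fidelity (σ a) (σ b) = fidelity (σ b) (σ a) :=
  fidelity_comm (isDensityOperator_iff.1 (hσ a).isDensityOperator).1
    (isDensityOperator_iff.1 (hσ b).isDensityOperator).1

lemma eq_or_eq_swap_of_counts {a a' b b' : Fin 2 → Bool}
    (h1 : targetNumber a = targetNumber b) (h2 : targetNumber a' = targetNumber b')
    (h3 : hammingDist a a' = hammingDist b b') :
    (b = a ∧ b' = a') ∨ (b = ![a 1, a 0] ∧ b' = ![a' 1, a' 0]) := by
  -- Stated for individual Booleans, the claim is a finite check.
  have key : ∀ x y x' y' z w z' w' : Bool,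
      targetNumber ![x, y] = targetNumber ![z, w] → targetNumber ![x', y'] = targetNumber ![z', w'] →
      hammingDist ![x, y] ![x', y'] = hammingDist ![z, w] ![z', w'] →
      ((z = x ∧ w = y) ∧ z' = x' ∧ w' = y') ∨ ((z = y ∧ w = x) ∧ z' = y' ∧ w' = x') := by
    unfold targetNumber hammingDist
    decide
  have hvec : ∀ c : Fin 2 → Bool, c = ![c 0, c 1] := fun c => by
    ext i; fin_cases i <;> rfl
  have h := key (a 0) (a 1) (a' 0) (a' 1) (b 0) (b 1) (b' 0) (b' 1)
    (by rwa [← hvec, ← hvec]) (by rwa [← hvec, ← hvec]) (by rwa [← hvec, ← hvec, ← hvec, ← hvec])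
  rw [hvec b, hvec b', hvec a, hvec a']
  rcases h with ⟨⟨ha, hb⟩, hc, hd⟩ | ⟨⟨ha, hb⟩, hc, hd⟩
  · left
    rw [ha, hb, hc, hd]
    exact ⟨rfl, rfl⟩
  · right
    rw [ha, hb, hc, hd]
    exact ⟨rfl, rfl⟩

lemma fidelity_twoMode_congr {E : Bool → GPIChannel} {N : ℝ}
    {σ : (Fin 2 → Bool) → (ModeSpace (Fin 2) →L[ℂ] ModeSpace (Fin 2))}
    (hσ : ∀ a, IsTwoModeOutput E N a (σ a)) {a a' b b' : Fin 2 → Bool}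
    (h1 : targetNumber a = targetNumber b) (h2 : targetNumber a' = targetNumber b')
    (h3 : hammingDist a a' = hammingDist b b') :
    fidelity (σ a) (σ a') = fidelity (σ b) (σ b') := by
  rcases eq_or_eq_swap_of_counts h1 h2 h3 with ⟨rfl, rfl⟩ | ⟨rfl, rfl⟩
  · rfl
  · have h : ∀ c : Fin 2 → Bool, ![c 0, c 1] = c := fun c => by
      ext i; fin_cases i <;> rfl
    rw [fidelity_twoMode_swap hσ, h, h]

lemma channelCM_kmax_apply {m : ℕ} (E : Bool → GPIChannel) (N : ℝ) (i : Fin m → Bool)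
    (x y : ProbeMode m × Fin 2) :
    channelCM (fun x => E (modifiedPattern i x)) (kmaxInputCM m N) x y =
      if x.1.1 = y.1.1 then
        channelCM (fun k => E ((![i x.1.1.1.1, i x.1.1.1.2] : Fin 2 → Bool) k)) (tmsvCM N)
          (x.1.2, x.2) (y.1.2, y.2)
      else 0 := by
  rw [channelCM_apply, channelCM_apply]
  obtain ⟨⟨d, k⟩, a⟩ := x
  obtain ⟨⟨d', k'⟩, a'⟩ := y
  have hp : ∀ (d : ProbeDomain m) (k : Fin 2), modifiedPattern i (d, k) =
      (![i d.1.1, i d.1.2] : Fin 2 → Bool) k := by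
    intro d k
    fin_cases k <;> simp [modifiedPattern, channelOf]
  by_cases h : d = d'
  · subst h
    simp [hp, kmaxInputCM]
  · simp [h, kmaxInputCM]

lemma IsKmaxOutput.isTensorOp {m : ℕ} {E : Bool → GPIChannel} {N : ℝ} {i : Fin m → Bool}
    {ρ : ModeSpace (ProbeMode m) →L[ℂ] ModeSpace (ProbeMode m)}
    (hρ : IsKmaxOutput E N i ρ)
    {σ : (Fin 2 → Bool) → (ModeSpace (Fin 2) →L[ℂ] ModeSpace (Fin 2))}
    (hσ : ∀ a, IsTwoModeOutput E N a (σ a)) :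
    IsTensorOp (prodWaveL (ProbeDomain m) (Fin 2)) ρ
      fun d => σ ![i d.1.1, i d.1.2] := by
  refine IsGaussianState.isTensorOp (fun ξ => ?_) hρ fun d => hσ ![i d.1.1, i d.1.2]
  simp only [dotProduct, Matrix.mulVec, channelCM_kmax_apply]
  rw [Fintype.sum_prod_type, Fintype.sum_prod_type]
  refine Finset.sum_congr rfl fun d _ => ?_
  rw [Fintype.sum_prod_type]
  refine Finset.sum_congr rfl fun k _ => Finset.sum_congr rfl fun a _ => ?_
  congr 1
  rw [Fintype.sum_prod_type, Fintype.sum_prod_type, Fintype.sum_prod_type]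
  simp only [ite_mul, zero_mul]
  rw [Finset.sum_eq_single d]
  · simp
  · intro d' _ hd'
    simp [hd'.symm]
  · simp

lemma fidelity_kmax {m : ℕ} {E : Bool → GPIChannel} {N : ℝ} {i i' : Fin m → Bool}
    {ρ ρ' : ModeSpace (ProbeMode m) →L[ℂ] ModeSpace (ProbeMode m)}
    (hρ : IsKmaxOutput E N i ρ) (hρ' : IsKmaxOutput E N i' ρ')
    {σ : (Fin 2 → Bool) → (ModeSpace (Fin 2) →L[ℂ] ModeSpace (Fin 2))}
    (hσ : ∀ a, IsTwoModeOutput E N a (σ a)) :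
    fidelity ρ ρ' = ∏ d : ProbeDomain m,
      fidelity (σ ![i d.1.1, i d.1.2]) (σ ![i' d.1.1, i' d.1.2]) := by
  have h0 := fun a => (isDensityOperator_iff.1 (hσ a).isDensityOperator).1
  exact isHilbertTensor_prodWaveL.fidelity_eq_prod (fun d => h0 _) (fun d => h0 _)
    (hρ.isTensorOp hσ) (hρ'.isTensorOp hσ)

end Outputs

/-! ## Counting pairs of channels -/

section Counting

/-- Indicator of the values `(a, b)` of a channel in two patterns. -/
def colInd (a b x x' : Bool) : ℕ := if x = a ∧ x' = b then 1 else 0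

/-- For each choice of bits at most one exponent is nonzero, and it is then 1; all vanish exactly
when the two patterns agree on the pair, where the fidelity is 1. Writing exponents as symmetric
polynomials in indicators lets products over pairs become sums of exponents. -/
lemma fidelity_twoMode_eq {E : Bool → GPIChannel} {N : ℝ}
    {σ : (Fin 2 → Bool) → (ModeSpace (Fin 2) →L[ℂ] ModeSpace (Fin 2))}
    (hσ : ∀ a, IsTwoModeOutput E N a (σ a)) (x y x' y' : Bool) :
    fidelity (σ ![x, y]) (σ ![x', y']) =
      fidelity (σ ![false, false]) (σ ![false, true]) ^
        (colInd false false x x' * (colInd false true y y' + colInd true false y y') +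
          colInd false false y y' * (colInd false true x x' + colInd true false x x')) *
      fidelity (σ ![false, true]) (σ ![true, false]) ^
        (colInd false true x x' * colInd true false y y' +
          colInd false true y y' * colInd true false x x') *
      fidelity (σ ![false, false]) (σ ![true, true]) ^
        (colInd false true x x' * colInd false true y y' +
          colInd true false x x' * colInd true false y y') *
      fidelity (σ ![false, true]) (σ ![true, true]) ^
        (colInd true true x x' * (colInd false true y y' + colInd true false y y') +
          colInd true true y y' * (colInd false true x x' + colInd true false x x')) := by
  have hs := fidelity_twoMode_swap hσ
  have hc := fidelity_twoMode_comm hσ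
  have h1 := fun a => fidelity_self (hσ a).isDensityOperator
  have e1 := hs false true false false
  have e2 := hs false true true false
  have e3 := hs false true true true
  have e4 := hc ![false, true] ![false, false]
  have e5 := hc ![true, false] ![false, false]
  have e6 := hc ![true, true] ![false, false]
  have e7 := hc ![true, true] ![false, true]
  have e8 := hc ![true, true] ![true, false]
  have e9 := hc ![false, false] ![true, false]
  cases x <;> cases y <;> cases x' <;> cases y' <;> simp [colInd, h1] <;> grind

lemma two_mul_sum_probeDomain {m : ℕ} (s : Fin m → Fin m → ℝ) (hs : ∀ j k, s j k = s k j) :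
    2 * ∑ d : ProbeDomain m, s d.1.1 d.1.2 + ∑ j, s j j = ∑ j, ∑ k, s j k := by
  have h1 : ∑ d : ProbeDomain m, s d.1.1 d.1.2 = ∑ j, ∑ k, if j < k then s j k else 0 := by
    rw [← Fintype.sum_prod_type' (f := fun j k => if j < k then s j k else 0),
      ← Finset.sum_filter]
    exact (Finset.sum_subtype _ (by simp) fun p : Fin m × Fin m => s p.1 p.2).symm
  have h2 : ∑ d : ProbeDomain m, s d.1.1 d.1.2 = ∑ j, ∑ k, if k < j then s j k else 0 := by
    rw [h1, Finset.sum_comm]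
    exact Finset.sum_congr rfl fun k _ => Finset.sum_congr rfl fun j _ => by rw [hs]
  have h3 : ∑ j, s j j = ∑ j, ∑ k, if j = k then s j k else 0 :=
    Finset.sum_congr rfl fun j _ => by simp
  rw [two_mul]
  nth_rewrite 1 [h1]
  rw [h2, h3, ← Finset.sum_add_distrib, ← Finset.sum_add_distrib]
  refine Finset.sum_congr rfl fun j _ => ?_
  rw [← Finset.sum_add_distrib, ← Finset.sum_add_distrib]
  refine Finset.sum_congr rfl fun k _ => ?_
  rcases lt_trichotomy j k with h | h | h
  · simp [h, h.not_gt, h.ne]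
  · simp [h]
  · simp [h, h.not_gt, h.ne']

/-- Sums over pairs of symmetrized products of functions of one channel. -/
lemma sum_probeDomain_symm_mul {m : ℕ} (f g : Fin m → ℕ) (h : ∀ j, f j * g j = 0) :
    ((∑ d : ProbeDomain m, (f d.1.1 * g d.1.2 + f d.1.2 * g d.1.1) : ℕ) : ℝ) =
      (∑ j, (f j : ℝ)) * ∑ j, (g j : ℝ) := by
  have h1 := two_mul_sum_probeDomain (fun j k : Fin m => (f j * g k + f k * g j : ℝ))
    fun j k => add_comm _ _
  have h2 : ∀ j, (f j * g j + f j * g j : ℝ) = 0 := fun j => by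
    have : (f j * g j : ℝ) = 0 := by exact_mod_cast h j
    rw [this, add_zero]
  have h3 : ∑ j, ∑ k, (f j * g k + f k * g j : ℝ) =
      2 * ((∑ j, (f j : ℝ)) * ∑ j, (g j : ℝ)) := by
    simp_rw [Finset.sum_add_distrib]
    rw [two_mul, Finset.sum_mul_sum]
    congr 1
    exact Finset.sum_comm
  simp_rw [h2, h3, Finset.sum_const_zero, add_zero] at h1
  push_cast
  linarith

/-- For an indicator of n channels this is the number n(n - 1)/2 of pairs among them. -/
lemma sum_probeDomain_mul_self {m : ℕ} (f : Fin m → ℕ) (h : ∀ j, f j * f j = f j) :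
    ((∑ d : ProbeDomain m, f d.1.1 * f d.1.2 : ℕ) : ℝ) =
      ((∑ j, (f j : ℝ)) ^ 2 - ∑ j, (f j : ℝ)) / 2 := by
  have h1 := two_mul_sum_probeDomain (fun j k : Fin m => (f j * f k : ℝ))
    fun j k => mul_comm _ _
  have h2 : ∀ j, (f j * f j : ℝ) = f j := fun j => by exact_mod_cast h j
  simp_rw [h2, ← Finset.sum_mul_sum, ← sq] at h1
  push_cast
  linarith

end Counting

end BosonicPattern

/-! ### The fidelity formula -/

theorem mainTheorem4
    (E : Bool → BosonicPattern.GPIChannel) (N : ℝ) (hN : 0 ≤ N)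
    -- the output states of a single TMSV probe, one for each two-channel pattern
    (σ : (Fin 2 → Bool) →
      (BosonicPattern.ModeSpace (Fin 2) →L[ℂ] BosonicPattern.ModeSpace (Fin 2)))
    (hσ : ∀ a, BosonicPattern.IsTwoModeOutput E N a (σ a))
    -- the four two-mode sub-fidelities
    (F01 F11 F02 F12 : ℝ)
    (hF01 : F01 = BosonicPattern.fidelity (σ ![false, false]) (σ ![false, true]))
    (hF11 : F11 = BosonicPattern.fidelity (σ ![false, true]) (σ ![true, false]))
    (hF02 : F02 = BosonicPattern.fidelity (σ ![false, false]) (σ ![true, true]))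
    (hF12 : F12 = BosonicPattern.fidelity (σ ![false, true]) (σ ![true, true])) :
    -- the two-mode fidelity only depends on target numbers and Hamming distance
    (∀ a a' b b' : Fin 2 → Bool,
      BosonicPattern.targetNumber a = BosonicPattern.targetNumber b →
      BosonicPattern.targetNumber a' = BosonicPattern.targetNumber b' →
      hammingDist a a' = hammingDist b b' →
      BosonicPattern.fidelity (σ a) (σ a') = BosonicPattern.fidelity (σ b) (σ b')) ∧
    -- the fidelity formula for the full protocol
    (∀ (m u v d : ℕ) (i i' : Fin m → Bool),
      BosonicPattern.targetNumber i = u → BosonicPattern.targetNumber i' = v → u ≤ v →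
      hammingDist i i' = d →
      ∀ ρ ρ' : BosonicPattern.ModeSpace (BosonicPattern.ProbeMode m) →L[ℂ]
          BosonicPattern.ModeSpace (BosonicPattern.ProbeMode m),
        BosonicPattern.IsKmaxOutput E N i ρ → BosonicPattern.IsKmaxOutput E N i' ρ' →
        ∀ dmin : ℝ, dmin = (v : ℝ) - (u : ℝ) →
          BosonicPattern.fidelity ρ ρ' =
              F01 ^ ((2 * (d : ℝ) * ((m : ℝ) - v) - (d : ℝ) ^ 2 + d * dmin) / 2) *
              F11 ^ (((d : ℝ) ^ 2 - dmin ^ 2) / 4) *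
              F02 ^ (((d : ℝ) * ((d : ℝ) - 2) + dmin ^ 2) / 4) *
              F12 ^ ((d : ℝ) * (2 * (v : ℝ) - d - dmin) / 2) ∧
          (u = v →
            BosonicPattern.fidelity ρ ρ' =
              F01 ^ ((d : ℝ) * (2 * ((m : ℝ) - u) - d) / 2) *
              F11 ^ ((d : ℝ) ^ 2 / 4) *
              F02 ^ ((d : ℝ) * ((d : ℝ) - 2) / 4) *
              F12 ^ ((d : ℝ) * (2 * (u : ℝ) - d) / 2))) := by
  refine ⟨fun a a' b b' h1 h2 h3 => BosonicPattern.fidelity_twoMode_congr hσ h1 h2 h3, ?_⟩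
  intro m u v d i i' hu hv _ hd ρ ρ' hρ hρ' dmin hdmin
  -- n a b counts the channels with value a in `i` and b in `i'`; m, u, v and d are sums of these
  -- four counts.
  set n : Bool → Bool → ℝ := fun a b => ∑ j, (BosonicPattern.colInd a b (i j) (i' j) : ℝ) with hn
  have hm' : (m : ℝ) = n false false + n false true + n true false + n true true := by
    simp only [hn, ← Finset.sum_add_distrib]
    rw [Finset.sum_congr rfl (g := fun _ => (1 : ℝ)), Finset.sum_const, Finset.card_univ,
      Fintype.card_fin, nsmul_eq_mul, mul_one]
    intro j _
    cases i j <;> cases i' j <;> simp [BosonicPattern.colInd]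
  have hu' : (u : ℝ) = n true false + n true true := by
    simp only [hn, ← Finset.sum_add_distrib]
    rw [← hu, BosonicPattern.targetNumber, Finset.card_filter, Nat.cast_sum]
    refine Finset.sum_congr rfl fun j _ => ?_
    cases i j <;> cases i' j <;> simp [BosonicPattern.colInd]
  have hv' : (v : ℝ) = n false true + n true true := by
    simp only [hn, ← Finset.sum_add_distrib]
    rw [← hv, BosonicPattern.targetNumber, Finset.card_filter, Nat.cast_sum]
    refine Finset.sum_congr rfl fun j _ => ?_
    cases i j <;> cases i' j <;> simp [BosonicPattern.colInd]
  have hd' : (d : ℝ) = n false true + n true false := by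
    simp only [hn, ← Finset.sum_add_distrib]
    rw [← hd, hammingDist, Finset.card_filter, Nat.cast_sum]
    refine Finset.sum_congr rfl fun j _ => ?_
    cases i j <;> cases i' j <;> simp [BosonicPattern.colInd]
  have hF := BosonicPattern.fidelity_kmax hρ hρ' hσ
  simp_rw [BosonicPattern.fidelity_twoMode_eq hσ (i _) (i _) (i' _) (i' _)] at hF
  rw [← hF01, ← hF11, ← hF02, ← hF12] at hF
  simp_rw [Finset.prod_mul_distrib, Finset.prod_pow_eq_pow_sum] at hF
  -- Exponents are collected as natural numbers first and cast afterwards, so no positivity of the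
  -- sub-fidelities is needed, even if one of them were 0.
  simp only [← Real.rpow_natCast] at hF
  rw [BosonicPattern.sum_probeDomain_symm_mul
      (fun j => BosonicPattern.colInd false false (i j) (i' j))
      (fun j => BosonicPattern.colInd false true (i j) (i' j) +
        BosonicPattern.colInd true false (i j) (i' j))
      (fun j => by cases i j <;> cases i' j <;> simp [BosonicPattern.colInd]),
    BosonicPattern.sum_probeDomain_symm_mul
      (fun j => BosonicPattern.colInd true true (i j) (i' j))
      (fun j => BosonicPattern.colInd false true (i j) (i' j) +
        BosonicPattern.colInd true false (i j) (i' j))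
      (fun j => by cases i j <;> cases i' j <;> simp [BosonicPattern.colInd]),
    BosonicPattern.sum_probeDomain_symm_mul
      (fun j => BosonicPattern.colInd false true (i j) (i' j))
      (fun j => BosonicPattern.colInd true false (i j) (i' j))
      (fun j => by cases i j <;> cases i' j <;> simp [BosonicPattern.colInd]),
    Finset.sum_add_distrib, Nat.cast_add,
    BosonicPattern.sum_probeDomain_mul_self
      (fun j => BosonicPattern.colInd false true (i j) (i' j))
      (fun j => by cases i j <;> cases i' j <;> simp [BosonicPattern.colInd]),
    BosonicPattern.sum_probeDomain_mul_self
      (fun j => BosonicPattern.colInd true false (i j) (i' j))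
      (fun j => by cases i j <;> cases i' j <;> simp [BosonicPattern.colInd])] at hF
  simp only [Nat.cast_add, Finset.sum_add_distrib] at hF
  have hmain : BosonicPattern.fidelity ρ ρ' =
      F01 ^ ((2 * (d : ℝ) * ((m : ℝ) - v) - (d : ℝ) ^ 2 + d * dmin) / 2) *
      F11 ^ (((d : ℝ) ^ 2 - dmin ^ 2) / 4) *
      F02 ^ (((d : ℝ) * ((d : ℝ) - 2) + dmin ^ 2) / 4) *
      F12 ^ ((d : ℝ) * (2 * (v : ℝ) - d - dmin) / 2) := by
    rw [hF, hdmin, hu', hv', hd', hm']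
    simp only [hn]
    -- The bases match factor by factor; each pair of exponents agrees as polynomials in the four
    -- counts.
    refine congrArg₂ (· * ·) (congrArg₂ (· * ·) (congrArg₂ (· * ·) ?_ ?_) ?_) ?_ <;>
      exact congrArg (_ ^ ·) (by ring)
  refine ⟨hmain, fun huv => ?_⟩
  have h0 : dmin = 0 := by rw [hdmin, huv, sub_self]
  rw [hmain, h0, huv]
  refine congrArg₂ (· * ·) (congrArg₂ (· * ·) (congrArg₂ (· * ·) ?_ ?_) ?_) ?_ <;>
    exact congrArg (_ ^ ·) (by ring)
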